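/- Let $(\mathcal M,\mathfrak g)$ be a geodesically complete smooth Riemannian manifold of finite dimension, so that the exponential map $\mathrm{Exp}_x:T_x\mathcal M\to\mathcal M$ is defined on every tangent space. Let $n\ge 1$, let $f_1,\dots,f_n:\mathcal M\to\mathbb R$ be differentiable, put $f=\frac1n\sum_{i=1}^n f_i$, and let $\nabla$ denote the Riemannian gradient. Assume: * (geodesic $L$-smoothness, $L>0$) for every $i$ and every geodesic $c:[0,1]\to\mathcal M$ with $c(0)=y$, $c(1)=x$, one has $\|\nabla f_i(x)-\Gamma_y^x\nabla f_i(y)\|\le L\|\dot c(0)\|$, where $\Gamma_y^x$ is parallel transport along $c$ (if any two points are joined by a unique geodesic, then $\|\dot c(0)\|=\|\mathrm{Exp}_x^{-1}(y)\|$); * (Polyak–Łojasiewicz condition) there are $\mu>0$ and $f^*\in\mathbb R$ with $f(x)\ge f^*$ and $2\mu\,(f(x)-f^*)\le\|\nabla f(x)\|^2$ for all $x\in\mathcal M$; * (unbiased compressors) $\omega\ge0$, and $\mathcal Q_1,\dots,\mathcal Q_n$ are stochastic mappings $T_x\mathcal M\to T_x\mathcal M$ ($x\in\mathcal M$) such that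 $\mathbb E[\mathcal Q_i(y)]=y$ and $\mathbb E\|\mathcal Q_i(y)-y\|^2\le\omega\|y\|^2$ for all $x\in\mathcal M$ and $y\in T_x\mathcal M$. Let $p\in(0,1]$, let $x^0\in\mathcal M$, and let the stepsize $\gamma>0$ satisfy $$\gamma\le\min\left\{\frac{1}{L\left(1+\sqrt{\frac{2(1-p)\omega}{pn}}\right)},\ \frac{p}{2\mu}\right\}.$$ R-MARINA starts from $x^0$ and $g_i^0=\nabla f_i(x^0)$. For $k=0,1,\dots$ it sets $g^k=\frac1n\sum_{i=1}^n g_i^k$ and $x^{k+1}=\mathrm{Exp}_{x^k}(-\gamma g^k)$, tosses one coin common to all workers, and puts, for all $i$, $$g_i^{k+1}=\nabla f_i(x^{k+1})\quad\text{with probability } p,$$ $$g_i^{k+1}=\Gamma_{x^k}^{x^{k+1}}g_i^k+\mathcal Q_i\left(\nabla f_i(x^{k+1})-\Gamma_{x^k}^{x^{k+1}}\nabla f_i(x^k)\right)\quad\text{with probability } 1-p,$$ where $\Gamma_{x^k}^{x^{k+1}}$ is parallel transport along the geodesic $t\mapsto\mathrm{Exp}_{x^k}(-t\gamma g^k)$,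 and the coin and the randomness of the $n$ compressors in iteration $k$ are independent of each other and of the past. Then for every $K\ge0$ the random variable $f(x^K)$ is integrable and $$\mathbb E\left[f(x^K)-f^*\right]\le(1-\gamma\mu)^K\left(f(x^0)-f^*\right).$$ If $x^*$ is a minimizer of $f$, then also $$\mathbb E\left[f(x^K)-f(x^*)\right]\le(1-\gamma\mu)^K\left(f(x^0)-f(x^*)\right).$$ -/

import Mathlib

open Bundle Set MeasureTheory ProbabilityTheory
open scoped Manifold ContDiff

noncomputable section

namespace RMarina

section Geometry

variable {d : ℕ} {M : Type*} [TopologicalSpace M] [ChartedSpace (EuclideanSpace ℝ (Fin d)) M]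
  [IsManifold (𝓡 d) ∞ M]
  [RiemannianBundle (fun x : M => TangentSpace (𝓡 d) x)]

/-- The coordinates, in the chart around `c`, of a tangent vector `v` at `x`. -/
def coord (c x : M) (v : TangentSpace (𝓡 d) x) : EuclideanSpace ℝ (Fin d) :=
  (trivializationAt (EuclideanSpace ℝ (Fin d)) (fun y : M => TangentSpace (𝓡 d) y)
    c).continuousLinearMapAt ℝ x v

/-- The metric `𝔤(a, b)` in the chart around `c`, at the point with coordinates `z`. -/
def chartMetric (c : M) (z a b : EuclideanSpace ℝ (Fin d)) : ℝ :=
  let x : M := (extChartAt (𝓡 d) c).symm z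
  let e := trivializationAt (EuclideanSpace ℝ (Fin d)) (fun y : M => TangentSpace (𝓡 d) y) c
  inner ℝ (e.symmL ℝ x a) (e.symmL ℝ x b)

/-- The Christoffel symbols of the first kind of the Levi-Civita connection in the chart around
`c`: `½ (∂ₐ 𝔤(b, w) + ∂_b 𝔤(a, w) - ∂_w 𝔤(a, b))`. -/
def christoffel (c : M) (z a b w : EuclideanSpace ℝ (Fin d)) : ℝ :=
  (fderiv ℝ (fun y => chartMetric c y b w) z a + fderiv ℝ (fun y => chartMetric c y a w) z b
    - fderiv ℝ (fun y => chartMetric c y a b) z w) / 2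

/-- The velocity of a curve. -/
def velocity (γ : ℝ → M) (t : ℝ) : TangentSpace (𝓡 d) (γ t) :=
  mfderiv 𝓘(ℝ, ℝ) (𝓡 d) γ t (1 : ℝ)

/-- The vector field `V` along `γ` is parallel (for the Levi-Civita connection) on the interval
`J`: in each chart, its coordinates satisfy `𝔤(V', w) + Γ(γ', V, w) = 0` for all `w`, which is the
equation `∇_{γ'} V = 0` with the index lowered. -/
def IsParallelOn (γ : ℝ → M) (V : (t : ℝ) → TangentSpace (𝓡 d) (γ t)) (J : Set ℝ) : Prop :=
  ∀ t ∈ J, ∀ c : M, γ t ∈ (chartAt (EuclideanSpace ℝ (Fin d)) c).source →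
    ∃ V' : EuclideanSpace ℝ (Fin d),
      HasDerivWithinAt (fun s => coord c (γ s) (V s)) V' J t ∧
      ∀ w : EuclideanSpace ℝ (Fin d),
        chartMetric c (extChartAt (𝓡 d) c (γ t)) V' w +
          christoffel c (extChartAt (𝓡 d) c (γ t)) (coord c (γ t) (velocity γ t))
            (coord c (γ t) (V t)) w = 0

variable (d) in
/-- A geodesic: a smooth curve whose velocity is parallel along it. -/
def IsGeodesic (γ : ℝ → M) : Prop :=
  ContMDiff 𝓘(ℝ, ℝ) (𝓡 d) ∞ γ ∧ IsParallelOn γ (velocity (d := d) γ) univ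

/-- The geodesic `γ` starts at `x` with velocity `v`. -/
def IsGeodesicFrom (x : M) (v : TangentSpace (𝓡 d) x) (γ : ℝ → M) : Prop :=
  IsGeodesic d γ ∧
    (⟨γ 0, velocity γ 0⟩ : TangentBundle (𝓡 d) M) = (⟨x, v⟩ : TangentBundle (𝓡 d) M)

variable (d M) in
/-- Every initial condition is that of a geodesic defined for all times: the exponential map is
defined on the whole tangent bundle. -/
def GeodesicallyComplete : Prop :=
  ∀ (x : M) (v : TangentSpace (𝓡 d) x), ∃ γ : ℝ → M, IsGeodesicFrom x v γ

open Classical in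
/-- The geodesic `t ↦ Exp_x(t v)` (a constant curve if there is none). -/
def geodesic (x : M) (v : TangentSpace (𝓡 d) x) : ℝ → M :=
  if h : ∃ γ : ℝ → M, IsGeodesicFrom x v γ then h.choose else fun _ => x

/-- The exponential map `Exp_x(v)`. -/
def expMap (x : M) (v : TangentSpace (𝓡 d) x) : M := geodesic x v 1

open Classical in
/-- Parallel transport of a vector `w` at `x = γ 0` along `γ|_[0,1]` to the tangent space at
`γ 1`. -/
def transport (γ : ℝ → M) (x : M) (w : TangentSpace (𝓡 d) x) : TangentSpace (𝓡 d) (γ 1) :=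
  if h : ∃ V : (t : ℝ) → TangentSpace (𝓡 d) (γ t), IsParallelOn γ V (Icc 0 1) ∧
      (⟨γ 0, V 0⟩ : TangentBundle (𝓡 d) M) = (⟨x, w⟩ : TangentBundle (𝓡 d) M)
  then h.choose 1 else 0

/-- Parallel transport `Γ_x^y w` from `x` to `y = Exp_x(v)`, along the geodesic `t ↦ Exp_x(t v)`. -/
def expTransport (x : M) (v w : TangentSpace (𝓡 d) x) : TangentSpace (𝓡 d) (expMap x v) :=
  transport (geodesic x v) x w

/-- The Riemannian gradient: `⟨∇f(x), v⟩ = df_x(v)` for all `v`. -/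
def grad (f : M → ℝ) (x : M) : TangentSpace (𝓡 d) x :=
  haveI : FiniteDimensional ℝ (TangentSpace (𝓡 d) x) :=
    inferInstanceAs (FiniteDimensional ℝ (EuclideanSpace ℝ (Fin d)))
  haveI : CompleteSpace (TangentSpace (𝓡 d) x) := FiniteDimensional.complete ℝ _
  (InnerProductSpace.toDual ℝ (TangentSpace (𝓡 d) x)).symm (mfderiv (𝓡 d) 𝓘(ℝ, ℝ) f x)

/-- `f` is differentiable and its gradient is geodesically `L`-Lipschitz: for each geodesic `γ`
from `y = γ 0` to `x = γ 1`, `‖∇f(x) - Γ_y^x ∇f(y)‖ ≤ L ‖γ'(0)‖`, where `γ'(0) = Exp_y⁻¹(x)` when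
geodesics are unique. -/
def GSmooth (L : ℝ) (f : M → ℝ) : Prop :=
  MDifferentiable (𝓡 d) 𝓘(ℝ, ℝ) f ∧
    ∀ γ : ℝ → M, IsGeodesic d γ →
      ‖grad (d := d) f (γ 1) - transport γ (γ 0) (grad f (γ 0))‖ ≤ L * ‖velocity (d := d) γ 0‖

variable (d) in
/-- The Polyak-Łojasiewicz condition with constant `μ` and lower bound `fstar`. -/
def PLCondition (μ fstar : ℝ) (f : M → ℝ) : Prop :=
  (∀ x, fstar ≤ f x) ∧ ∀ x, 2 * μ * (f x - fstar) ≤ ‖grad (d := d) f x‖ ^ 2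

end Geometry

/-- The average `f = (1/n) ∑ fᵢ`. -/
def average {M : Type*} {n : ℕ} (f : Fin n → M → ℝ) (x : M) : ℝ := (n : ℝ)⁻¹ * ∑ i, f i x

/-- The tangent bundle carries its Borel σ-algebra. -/
instance tangentBundleMeasurableSpace {d : ℕ} {M : Type*} [TopologicalSpace M] [ChartedSpace (EuclideanSpace ℝ (Fin d)) M]
    [IsManifold (𝓡 d) ∞ M] : MeasurableSpace (TangentBundle (𝓡 d) M) := borel _

section Algorithm

variable {d n : ℕ} {M : Type*} [TopologicalSpace M] [ChartedSpace (EuclideanSpace ℝ (Fin d)) M]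
  [IsManifold (𝓡 d) ∞ M]
  [RiemannianBundle (fun x : M => TangentSpace (𝓡 d) x)]
  {S : Type*} [MeasurableSpace S]

/-- A stochastic mapping `T_xM → T_xM`, for all `x`, driven by a random seed `s` with law `ν`, is
an unbiased compressor with conic variance parameter `omega`. -/
structure IsUnbiasedCompressor (ν : Measure S) (omega : ℝ)
    (Q : (x : M) → S → TangentSpace (𝓡 d) x → TangentSpace (𝓡 d) x) : Prop where
  measurable : Measurable (fun q : S × TangentBundle (𝓡 d) M =>
    (⟨q.2.1, Q q.2.1 q.1 q.2.2⟩ : TangentBundle (𝓡 d) M))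
  integrable : ∀ (x : M) (y : TangentSpace (𝓡 d) x), Integrable (fun s => Q x s y) ν
  unbiased : ∀ (x : M) (y : TangentSpace (𝓡 d) x), ∫ s, Q x s y ∂ν = y
  integrable_sq : ∀ (x : M) (y : TangentSpace (𝓡 d) x),
    Integrable (fun s => ‖Q x s y - y‖ ^ 2) ν
  variance_le : ∀ (x : M) (y : TangentSpace (𝓡 d) x),
    ∫ s, ‖Q x s y - y‖ ^ 2 ∂ν ≤ omega * ‖y‖ ^ 2

variable (d n M) in
/-- The state of the method after `k` iterations: the point `xᵏ` and the vectors `gᵢᵏ ∈ T_{xᵏ}M`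
held by the `n` workers. -/
structure State where
  point : M
  vec : Fin n → TangentSpace (𝓡 d) point

namespace State

/-- `gᵏ = (1/n) ∑ gᵢᵏ`. -/
def mean (σ : State d n M) : TangentSpace (𝓡 d) σ.point := (n : ℝ)⁻¹ • ∑ i, σ.vec i

/-- `xᵏ⁺¹ = Exp_{xᵏ}(-η gᵏ)`. -/
def next (η : ℝ) (σ : State d n M) : M := expMap σ.point (-(η • σ.mean))

/-- Parallel transport `Γ_{xᵏ}^{xᵏ⁺¹} w`. -/
def move (η : ℝ) (σ : State d n M) (w : TangentSpace (𝓡 d) σ.point) :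
    TangentSpace (𝓡 d) (σ.next η) := expTransport σ.point (-(η • σ.mean)) w

/-- The gradient difference `∇fᵢ(xᵏ⁺¹) - Γ_{xᵏ}^{xᵏ⁺¹} ∇fᵢ(xᵏ)`. -/
def diff (f : Fin n → M → ℝ) (η : ℝ) (σ : State d n M) (i : Fin n) :
    TangentSpace (𝓡 d) (σ.next η) := grad (f i) (σ.next η) - σ.move η (grad (f i) σ.point)

/-- One iteration. The coin is common to all workers; `s i` is the seed of the compressor of the
`i`-th worker. -/
def step (f : Fin n → M → ℝ)
    (Q : Fin n → (x : M) → S → TangentSpace (𝓡 d) x → TangentSpace (𝓡 d) x) (η : ℝ)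
    (coin : Bool) (s : Fin n → S) (σ : State d n M) : State d n M where
  point := σ.next η
  vec := fun i =>
    if coin then grad (f i) (σ.next η)
    else σ.move η (σ.vec i) + Q i (σ.next η) (s i) (σ.diff f η i)

end State

/-- R-MARINA started at `x₀`, with `gᵢ⁰ = ∇fᵢ(x₀)`; iteration `k` uses the coin `(z k).1` and the
seeds `(z k).2`. -/
def run (f : Fin n → M → ℝ)
    (Q : Fin n → (x : M) → S → TangentSpace (𝓡 d) x → TangentSpace (𝓡 d) x) (η : ℝ) (x₀ : M)
    (z : ℕ → Bool × (Fin n → S)) : ℕ → State d n M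
  | 0 => ⟨x₀, fun i => grad (f i) x₀⟩
  | k + 1 => (run f Q η x₀ z k).step f Q η (z k).1 (z k).2

/-- The random iterate `xᵏ`, as a function of the outcome `a`. -/
def iterate {Ω : Type*} (f : Fin n → M → ℝ)
    (Q : Fin n → (x : M) → S → TangentSpace (𝓡 d) x → TangentSpace (𝓡 d) x) (η : ℝ) (x₀ : M)
    (Z : ℕ → Ω → Bool × (Fin n → S)) (k : ℕ) (a : Ω) : M :=
  (run f Q η x₀ (fun j => Z j a) k).point

/-- The law of the randomness of one iteration: a coin showing `true` with probability `p`, and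
`n` seeds with law `ν`, all independent. -/
def stepLaw (n : ℕ) (p : ℝ) (ν : Measure S) : Measure (Bool × (Fin n → S)) :=
  (ENNReal.ofReal p • Measure.dirac true + ENNReal.ofReal (1 - p) • Measure.dirac false).prod
    (Measure.pi fun _ => ν)

/-- All the vectors that occur in the run `σ` before the coin and the seeds of iteration `k` are
drawn are random vectors determined by the past `ℱ k`. -/
def Adapted {Ω : Type*} [mΩ : MeasurableSpace Ω] (ℱ : Filtration ℕ mΩ) (f : Fin n → M → ℝ) (η : ℝ)
    (σ : ℕ → Ω → State d n M) : Prop :=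
  ∀ (k : ℕ) (i : Fin n),
    Measurable[ℱ k] (fun a => (⟨(σ k a).point, (σ k a).vec i⟩ : TangentBundle (𝓡 d) M)) ∧
    Measurable[ℱ k]
      (fun a => (⟨(σ k a).point, grad (f i) (σ k a).point⟩ : TangentBundle (𝓡 d) M)) ∧
    Measurable[ℱ k]
      (fun a => (⟨(σ k a).next η, (σ k a).move η ((σ k a).vec i)⟩ : TangentBundle (𝓡 d) M)) ∧
    Measurable[ℱ k]
      (fun a => (⟨(σ k a).next η, (σ k a).diff f η i⟩ : TangentBundle (𝓡 d) M))

end Algorithm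

end RMarina

end

noncomputable section

namespace RMarina

set_option linter.unusedSectionVars false
set_option maxSynthPendingDepth 3

/-! ### Charts, coordinates of tangent vectors, transition maps. -/

section ChartGeometry

variable {d : ℕ} {M : Type*} [TopologicalSpace M] [ChartedSpace (EuclideanSpace ℝ (Fin d)) M]
  [IsManifold (𝓡 d) ∞ M]

local notation "𝔼" => EuclideanSpace ℝ (Fin d)

/-! The Lyapunov function Φ = f(x) - f* + (γ/p)‖g - ∇f(x)‖² (`State.lyapunov` with weight `γ / p`)
contracts by 1 - γμ in expectation at every iteration. Geodesic smoothness gives f(Exp_x v) ≤ f(x) +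
⟨∇f(x), v⟩ + (L/2)‖v‖² (`GSmooth.le_of_isGeodesic`, averaged in `average_expMap_le`). For v = -γg,
polarisation turns the inner product into (γ/2)(‖g - ∇f‖² - ‖g‖² - ‖∇f‖²), and the
Polyak–Łojasiewicz condition turns the last term into a decrease of f - f*. A coin showing `true`
resets the error g - ∇f to zero; otherwise the new error is the transported old one plus an average
of independent centred compression noises (`State.errNext_false`). Since transport is isometric, its
second moment is then at most ‖g - ∇f‖² + ωL²γ²‖g‖²/n (`lintegral_norm_sq_const_add_sum`). The first
stepsize bound absorbs all ‖g‖² terms, the second makes the error term contract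
(`lyapunov_decrease`). The error starts at zero, so iteration gives the rate.

The geometry must supply parallel transport as a linear isometry. `IsParallelOn` asks for the
equation in every chart: a linear ODE is solved in one chart, carried to the others by the
transformation law of the Christoffel symbols (`ParallelEqAt.change`), and the pieces are glued
along a partition (`exists_isParallelOn`). Metricity makes inner products of parallel fields
constant, which gives both isometry and uniqueness.

Expectations are computed in `ENNReal`, so no integrability is needed in advance; that of f(xᴷ)
follows from the bound. Conditioning on the past is Fubini with the past frozen
(`lintegral_comp_indep`). The joint measurability it requires is checked in charts. -/

lemma extChart_mem_target {c x : M} (hx : x ∈ (chartAt 𝔼 c).source) :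
    extChartAt (𝓡 d) c x ∈ (extChartAt (𝓡 d) c).target :=
  (extChartAt (𝓡 d) c).map_source (by rwa [extChartAt_source])

lemma extChart_left_inv {c x : M} (hx : x ∈ (chartAt 𝔼 c).source) :
    (extChartAt (𝓡 d) c).symm (extChartAt (𝓡 d) c x) = x :=
  (extChartAt (𝓡 d) c).left_inv (by rwa [extChartAt_source])

lemma extChart_symm_mem {c : M} {z : 𝔼} (hz : z ∈ (extChartAt (𝓡 d) c).target) :
    (extChartAt (𝓡 d) c).symm z ∈ (chartAt 𝔼 c).source := by
  have := (extChartAt (𝓡 d) c).map_target hz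
  rwa [extChartAt_source] at this

lemma coord_add (c x : M) (v w : TangentSpace (𝓡 d) x) :
    coord c x (v + w) = coord c x v + coord c x w := map_add _ _ _

lemma coord_sub (c x : M) (v w : TangentSpace (𝓡 d) x) :
    coord c x (v - w) = coord c x v - coord c x w := map_sub _ _ _

lemma coord_smul (c x : M) (r : ℝ) (v : TangentSpace (𝓡 d) x) :
    coord c x (r • v) = r • coord c x v := map_smul _ _ _

lemma coord_sum (c x : M) {ι : Type*} (s : Finset ι) (v : ι → TangentSpace (𝓡 d) x) :
    coord c x (∑ i ∈ s, v i) = ∑ i ∈ s, coord c x (v i) := map_sum _ _ _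

/-- The tangent vector at `x` with coordinates `a` in the chart around `c`. -/
def uncoord (c x : M) (a : 𝔼) : TangentSpace (𝓡 d) x :=
  (trivializationAt 𝔼 (fun y : M => TangentSpace (𝓡 d) y) c).symmL ℝ x a

lemma uncoord_coord {c x : M} (hx : x ∈ (chartAt 𝔼 c).source) (v : TangentSpace (𝓡 d) x) :
    uncoord c x (coord c x v) = v :=
  (trivializationAt 𝔼 (fun y : M => TangentSpace (𝓡 d) y) c).symmL_continuousLinearMapAt (R := ℝ) hx v

lemma coord_uncoord {c x : M} (hx : x ∈ (chartAt 𝔼 c).source) (a : 𝔼) :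
    coord c x (uncoord c x a) = a :=
  (trivializationAt 𝔼 (fun y : M => TangentSpace (𝓡 d) y) c).continuousLinearMapAt_symmL (R := ℝ) hx a

lemma coord_eq_mfderiv {c x : M} (hx : x ∈ (chartAt 𝔼 c).source) (v : TangentSpace (𝓡 d) x) :
    coord c x v = mfderiv (𝓡 d) 𝓘(ℝ, 𝔼) (extChartAt (𝓡 d) c) x v := by
  rw [coord, TangentBundle.continuousLinearMapAt_trivializationAt hx]
  rfl

/-- The velocity of a curve in coordinates. -/
lemma hasDerivAt_extChart_comp {γ : ℝ → M} {t : ℝ} (hγ : MDifferentiableAt 𝓘(ℝ, ℝ) (𝓡 d) γ t)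
    {c : M} (hx : γ t ∈ (chartAt 𝔼 c).source) :
    HasDerivAt (fun s => extChartAt (𝓡 d) c (γ s)) (coord c (γ t) (velocity γ t)) t := by
  have h1 : MDifferentiableAt (𝓡 d) 𝓘(ℝ, 𝔼) (extChartAt (𝓡 d) c) (γ t) :=
    mdifferentiableAt_extChartAt hx
  have h2 := (h1.hasMFDerivAt.comp t hγ.hasMFDerivAt)
  let D : ℝ →L[ℝ] 𝔼 := (mfderiv (𝓡 d) 𝓘(ℝ, 𝔼) (extChartAt (𝓡 d) c) (γ t)).comp
    (mfderiv 𝓘(ℝ, ℝ) (𝓡 d) γ t)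
  have h3 : HasFDerivAt (fun s => extChartAt (𝓡 d) c (γ s)) D t := h2.hasFDerivAt
  rw [coord_eq_mfderiv hx]
  exact h3.hasDerivAt

/-- The transition map between the charts around `c` and `c'`. -/
def transition (c c' : M) (z : 𝔼) : 𝔼 := extChartAt (𝓡 d) c' ((extChartAt (𝓡 d) c).symm z)

/-- The domain of the transition map. -/
def overlap (c c' : M) : Set 𝔼 :=
  (extChartAt (𝓡 d) c).target ∩ (extChartAt (𝓡 d) c).symm ⁻¹' (chartAt 𝔼 c').source

lemma isOpen_overlap (c c' : M) : IsOpen (overlap (d := d) c c') :=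
  (continuousOn_extChartAt_symm c).isOpen_inter_preimage (isOpen_extChartAt_target c)
    (chartAt 𝔼 c').open_source

lemma extChart_mem_overlap {c c' x : M} (hx : x ∈ (chartAt 𝔼 c).source)
    (hx' : x ∈ (chartAt 𝔼 c').source) : extChartAt (𝓡 d) c x ∈ overlap c c' :=
  ⟨extChart_mem_target hx, by rw [mem_preimage, extChart_left_inv hx]; exact hx'⟩

lemma contDiffOn_transition (c c' : M) :
    ContDiffOn ℝ ∞ (transition (d := d) c c') (overlap c c') := by
  have h1 : ContMDiffOn 𝓘(ℝ, 𝔼) (𝓡 d) ∞ (extChartAt (𝓡 d) c).symm (extChartAt (𝓡 d) c).target :=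
    contMDiffOn_extChartAt_symm c
  have h2 : ContMDiffOn (𝓡 d) 𝓘(ℝ, 𝔼) ∞ (extChartAt (𝓡 d) c') (chartAt 𝔼 c').source :=
    contMDiffOn_extChartAt
  rw [← contMDiffOn_iff_contDiffOn]
  exact h2.comp (h1.mono inter_subset_left) inter_subset_right

lemma coord_change {c c' x : M} (hx : x ∈ (chartAt 𝔼 c).source)
    (hx' : x ∈ (chartAt 𝔼 c').source) (v : TangentSpace (𝓡 d) x) :
    coord c' x v = fderiv ℝ (transition c c') (extChartAt (𝓡 d) c x) (coord c x v) := by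
  have hz := extChart_mem_overlap hx hx'
  have h1 : MDifferentiableAt (𝓡 d) 𝓘(ℝ, 𝔼) (extChartAt (𝓡 d) c) x :=
    mdifferentiableAt_extChartAt hx
  have h2 : DifferentiableAt ℝ (transition (d := d) c c') (extChartAt (𝓡 d) c x) :=
    ((contDiffOn_transition c c').contDiffAt ((isOpen_overlap c c').mem_nhds hz)).differentiableAt
      (by simp)
  have h3 := h2.hasFDerivAt.hasMFDerivAt.comp x h1.hasMFDerivAt
  have h4 : (transition (d := d) c c' ∘ extChartAt (𝓡 d) c) =ᶠ[nhds x] extChartAt (𝓡 d) c' := by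
    filter_upwards [(chartAt 𝔼 c).open_source.mem_nhds hx] with y hy
    simp only [transition, Function.comp, extChart_left_inv hy]
  rw [coord_eq_mfderiv hx, coord_eq_mfderiv hx', ← h4.mfderiv_eq, h3.mfderiv]
  rfl

end ChartGeometry

/-! ### Christoffel symbols of a field of bilinear forms on a vector space. -/

section BilinearForms

variable {V : Type*} [NormedAddCommGroup V] [NormedSpace ℝ V]

/-- The Christoffel symbols of the first kind of a metric with derivative `D`. -/
def koszulForm (D : V →L[ℝ] V →L[ℝ] V →L[ℝ] ℝ) (a : V) : V →L[ℝ] V →L[ℝ] ℝ :=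
  (2⁻¹ : ℝ) • (D a + D.flip a - (D.flip a).flip)

lemma koszulForm_apply (D : V →L[ℝ] V →L[ℝ] V →L[ℝ] ℝ) (a b w : V) :
    koszulForm D a b w = (D a b w + D b a w - D w a b) / 2 := by
  simp [koszulForm]
  ring

lemma ContDiffAt.continuousAt_koszulForm {G : V → V →L[ℝ] V →L[ℝ] ℝ} {z : V}
    (hG : ContDiffAt ℝ ∞ G z) (a : V) :
    ContinuousAt (fun q : V × V => koszulForm (fderiv ℝ G q.1) q.2) (z, a) := by
  have h1 : ContinuousAt (fderiv ℝ G) z := hG.continuousAt_fderiv (by simp)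
  have h2 : ContinuousAt (fun q : V × V => fderiv ℝ G q.1) (z, a) :=
    ContinuousAt.comp (f := Prod.fst) h1 continuousAt_fst
  have h3 : ContinuousAt (fun q : V × V => (fderiv ℝ G q.1).flip) (z, a) :=
    (ContinuousLinearMap.flipₗᵢ ℝ V V (V →L[ℝ] ℝ)).continuous.continuousAt.comp h2
  have h4 : ContinuousAt (fun q : V × V => ((fderiv ℝ G q.1).flip q.2).flip) (z, a) :=
    (ContinuousLinearMap.flipₗᵢ ℝ V V ℝ).continuous.continuousAt.comp
      (h3.clm_apply continuousAt_snd)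
  exact (((h2.clm_apply continuousAt_snd).add (h3.clm_apply continuousAt_snd)).sub h4).const_smul (2⁻¹ : ℝ)

lemma fderiv_bilin_apply {G : V → V →L[ℝ] V →L[ℝ] ℝ} {z : V} (hG : ContDiffAt ℝ ∞ G z)
    (a b w : V) : fderiv ℝ (fun y => G y a b) z w = fderiv ℝ G z w a b := by
  have hd : HasFDerivAt G (fderiv ℝ G z) z := (hG.differentiableAt (by simp)).hasFDerivAt
  have h := (hd.clm_apply (hasFDerivAt_const a z)).clm_apply (hasFDerivAt_const b z)
  rw [h.fderiv]
  simp

end BilinearForms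

/-! ### The metric in a chart: smoothness, inverse, metricity. -/

section ChartMetric

variable {d : ℕ} {M : Type*} [TopologicalSpace M] [ChartedSpace (EuclideanSpace ℝ (Fin d)) M]
  [IsManifold (𝓡 d) ∞ M]
  [RiemannianBundle (fun x : M => TangentSpace (𝓡 d) x)]

local notation "𝔼" => EuclideanSpace ℝ (Fin d)

lemma inner_eq_chartMetric {c x : M} (hx : x ∈ (chartAt 𝔼 c).source)
    (v w : TangentSpace (𝓡 d) x) :
    inner ℝ v w = chartMetric c (extChartAt (𝓡 d) c x) (coord c x v) (coord c x w) := by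
  -- The chart inverse returns `x` only up to a propositional equality, and the fibre depends on it;
  -- with the point generalised, it can be substituted.
  have h : ∀ y : M, y = x → inner ℝ v w =
      inner ℝ (uncoord c y (coord c x v)) (uncoord c y (coord c x w)) := by
    rintro y rfl
    rw [uncoord_coord hx, uncoord_coord hx]
  exact h _ (extChart_left_inv hx)

/-- The metric in the chart around `c` as a bilinear form. -/
def metricForm (c : M) (z : 𝔼) : 𝔼 →L[ℝ] 𝔼 →L[ℝ] ℝ :=
  LinearMap.toContinuousLinearMap
    (LinearMap.toContinuousLinearMap.toLinearMap ∘ₗ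
      (LinearMap.mk₂ ℝ (chartMetric c z)
        (fun a b _ => (congrArg₂ _ (map_add _ a b) rfl).trans (inner_add_left _ _ _))
        (fun r a _ => (congrArg₂ _ (map_smul _ r a) rfl).trans (real_inner_smul_left _ _ _))
        (fun _ b w => (congrArg₂ _ rfl (map_add _ b w)).trans (inner_add_right _ _ _))
        (fun r _ b => (congrArg₂ _ rfl (map_smul _ r b)).trans (real_inner_smul_right _ _ _))))

lemma metricForm_apply (c : M) (z a b : 𝔼) : metricForm c z a b = chartMetric c z a b := rfl

lemma metricForm_symm (c : M) (z a b : 𝔼) : metricForm c z a b = metricForm c z b a := by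
  simp only [metricForm_apply, chartMetric]
  exact real_inner_comm _ _

lemma metricForm_pos {c : M} {z : 𝔼} (hz : z ∈ (extChartAt (𝓡 d) c).target) {a : 𝔼}
    (ha : metricForm c z a a = 0) : a = 0 := by
  have h : uncoord c ((extChartAt (𝓡 d) c).symm z) a = 0 := by
    rw [← inner_self_eq_zero (𝕜 := ℝ)]
    exact ha
  rw [← coord_uncoord (extChart_symm_mem hz) a, h]
  exact map_zero _

/-- The inverse of the metric in the chart around `c`. -/
def metricInv (c : M) (z : 𝔼) : (𝔼 →L[ℝ] ℝ) →L[ℝ] 𝔼 := (metricForm c z).inverse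

lemma exists_metricEquiv {c : M} {z : 𝔼} (hz : z ∈ (extChartAt (𝓡 d) c).target) :
    ∃ e : 𝔼 ≃L[ℝ] (𝔼 →L[ℝ] ℝ), (e : 𝔼 →L[ℝ] (𝔼 →L[ℝ] ℝ)) = metricForm c z := by
  have hinj : Function.Injective (metricForm c z).toLinearMap := by
    rw [← LinearMap.ker_eq_bot, LinearMap.ker_eq_bot']
    intro a ha
    refine metricForm_pos hz ?_
    have : metricForm c z a = 0 := ha
    rw [this]; rfl
  -- Nondegeneracy gives injectivity; equality of the dimensions upgrades it to an isomorphism onto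
  -- the dual.
  have hfin : Module.finrank ℝ 𝔼 = Module.finrank ℝ (𝔼 →L[ℝ] ℝ) :=
    LinearEquiv.finrank_eq (InnerProductSpace.toDual ℝ 𝔼).toLinearEquiv
  exact ⟨(LinearEquiv.ofInjectiveOfFinrankEq _ hinj hfin).toContinuousLinearEquiv, by ext; rfl⟩

lemma metricForm_metricInv {c : M} {z : 𝔼} (hz : z ∈ (extChartAt (𝓡 d) c).target)
    (φ : 𝔼 →L[ℝ] ℝ) : metricForm c z (metricInv c z φ) = φ := by
  obtain ⟨e, he⟩ := exists_metricEquiv hz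
  rw [metricInv, ← he, ContinuousLinearMap.inverse_equiv]
  exact e.apply_symm_apply φ

variable [IsContMDiffRiemannianBundle (𝓡 d) ∞ (EuclideanSpace ℝ (Fin d))
      (fun x : M => TangentSpace (𝓡 d) x)]

lemma contDiffOn_chartMetric (c : M) (a b : 𝔼) :
    ContDiffOn ℝ ∞ (fun z => chartMetric c z a b) (extChartAt (𝓡 d) c).target := by
  have h1 : ContMDiffOn 𝓘(ℝ, 𝔼) (𝓡 d) ∞ (extChartAt (𝓡 d) c).symm (extChartAt (𝓡 d) c).target :=
    contMDiffOn_extChartAt_symm c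
  have h2 : ∀ a : 𝔼, ContMDiffOn (𝓡 d) ((𝓡 d).prod 𝓘(ℝ, 𝔼)) ∞
      (fun x : M => (⟨x, uncoord c x a⟩ : TotalSpace 𝔼 (fun y : M => TangentSpace (𝓡 d) y)))
      (chartAt 𝔼 c).source := by
    intro a
    have h3 := (trivializationAt 𝔼 (fun y : M => TangentSpace (𝓡 d) y) c).contMDiffOn_symm
      (IB := 𝓡 d) (n := ∞)
    have h4 : ContMDiffOn (𝓡 d) ((𝓡 d).prod 𝓘(ℝ, 𝔼)) ∞ (fun x : M => (x, a))
      (chartAt 𝔼 c).source := (contMDiff_id.prodMk contMDiff_const).contMDiffOn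
    refine (h3.comp h4 ?_).congr ?_
    · intro x hx
      rw [mem_preimage, Trivialization.mem_target]
      exact hx
    · intro x hx
      simp only [Function.comp, uncoord]
      rw [← Trivialization.mk_symm _ (show x ∈ _ from hx), Trivialization.symmL_apply]
      exact hx
  have h5 := (h2 a).inner_bundle (h2 b)
  rw [← contMDiffOn_iff_contDiffOn]
  exact h5.comp h1 (fun z hz => extChart_symm_mem hz)

lemma contDiffOn_metricForm (c : M) :
    ContDiffOn ℝ ∞ (metricForm (d := d) c) (extChartAt (𝓡 d) c).target := by
  rw [contDiffOn_clm_apply]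
  intro a
  rw [contDiffOn_clm_apply]
  exact fun b => contDiffOn_chartMetric c a b

lemma contDiffAt_metricForm {c : M} {z : 𝔼} (hz : z ∈ (extChartAt (𝓡 d) c).target) :
    ContDiffAt ℝ ∞ (metricForm (d := d) c) z :=
  (contDiffOn_metricForm c).contDiffAt ((isOpen_extChartAt_target c).mem_nhds hz)

lemma fderiv_chartMetric {c : M} {z : 𝔼} (hz : z ∈ (extChartAt (𝓡 d) c).target) (a b w : 𝔼) :
    fderiv ℝ (fun y => chartMetric c y a b) z w = fderiv ℝ (metricForm c) z w a b :=
  fderiv_bilin_apply (contDiffAt_metricForm hz) a b w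

lemma continuousAt_metricInv {c : M} {z : 𝔼} (hz : z ∈ (extChartAt (𝓡 d) c).target) :
    ContinuousAt (metricInv (d := d) c) z := by
  obtain ⟨e, he⟩ := exists_metricEquiv hz
  have h1 : ContinuousAt ContinuousLinearMap.inverse (metricForm c z) := by
    rw [← he]
    exact (contDiffAt_map_inverse (n := 0) e).continuousAt
  exact h1.comp (f := metricForm c) (contDiffAt_metricForm hz).continuousAt

lemma koszulForm_metricForm {c : M} {z : 𝔼} (hz : z ∈ (extChartAt (𝓡 d) c).target) (a b w : 𝔼) :
    koszulForm (fderiv ℝ (metricForm c) z) a b w = christoffel c z a b w := by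
  rw [christoffel, fderiv_chartMetric hz, fderiv_chartMetric hz, fderiv_chartMetric hz,
    koszulForm_apply]

/-- Metricity of the connection. -/
lemma christoffel_add_swap {c : M} {z : 𝔼} (hz : z ∈ (extChartAt (𝓡 d) c).target) (a b w : 𝔼) :
    christoffel c z a b w + christoffel c z a w b = fderiv ℝ (metricForm c) z a b w := by
  have h : ∀ a b : 𝔼, (fun y => chartMetric c y a b) = fun y => chartMetric c y b a :=
    fun a b => funext fun y => metricForm_symm c y a b
  rw [christoffel, christoffel, h w b, fderiv_chartMetric hz,
    fderiv_chartMetric hz, fderiv_chartMetric hz]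
  ring

end ChartMetric

/-! ### Behaviour of Christoffel symbols under a change of coordinates. -/

section ChangeOfVariables

variable {V : Type*} [NormedAddCommGroup V] [NormedSpace ℝ V]

/-- Product rule for G = φ*G': one term from the metric and one from each of the two slots, where
the second derivative of φ enters. -/
lemma fderiv_pullback {G G' : V → V →L[ℝ] V →L[ℝ] ℝ} {φ : V → V} {z : V}
    (hG : ContDiffAt ℝ ∞ G z) (hG' : ContDiffAt ℝ ∞ G' (φ z)) (hφ : ContDiffAt ℝ ∞ φ z)
    (h : ∀ᶠ y in nhds z, ∀ a b, G y a b = G' (φ y) (fderiv ℝ φ y a) (fderiv ℝ φ y b))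
    (e a b : V) :
    fderiv ℝ G z e a b =
      fderiv ℝ G' (φ z) (fderiv ℝ φ z e) (fderiv ℝ φ z a) (fderiv ℝ φ z b)
        + G' (φ z) (fderiv ℝ (fderiv ℝ φ) z e a) (fderiv ℝ φ z b)
        + G' (φ z) (fderiv ℝ φ z a) (fderiv ℝ (fderiv ℝ φ) z e b) := by
  have h1 : HasFDerivAt φ (fderiv ℝ φ z) z := (hφ.differentiableAt (by simp)).hasFDerivAt
  have h2 : HasFDerivAt (fderiv ℝ φ) (fderiv ℝ (fderiv ℝ φ) z) z :=
    ((hφ.fderiv_right (m := ∞) (by simp)).differentiableAt (by simp)).hasFDerivAt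
  have h3 : HasFDerivAt G' (fderiv ℝ G' (φ z)) (φ z) :=
    (hG'.differentiableAt (by simp)).hasFDerivAt
  have h4 := ((h3.comp z h1).clm_apply (h2.clm_apply (hasFDerivAt_const a z))).clm_apply
    (h2.clm_apply (hasFDerivAt_const b z))
  have h5 : (fun y => G y a b) =ᶠ[nhds z]
      fun y => G' (φ y) (fderiv ℝ φ y a) (fderiv ℝ φ y b) := h.mono fun y hy => hy a b
  rw [← fderiv_bilin_apply hG, h5.fderiv_eq]
  have h6 : fderiv ℝ (fun y => G' (φ y) (fderiv ℝ φ y a) (fderiv ℝ φ y b)) z = _ := h4.fderiv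
  rw [h6]
  simp
  ring

/-- The transformation law of the Christoffel symbols under a change of coordinates. -/
lemma koszulForm_pullback {G G' : V → V →L[ℝ] V →L[ℝ] ℝ} {φ : V → V} {z : V}
    (hG : ContDiffAt ℝ ∞ G z) (hG' : ContDiffAt ℝ ∞ G' (φ z)) (hφ : ContDiffAt ℝ ∞ φ z)
    (h : ∀ᶠ y in nhds z, ∀ a b, G y a b = G' (φ y) (fderiv ℝ φ y a) (fderiv ℝ φ y b))
    (hsymm : ∀ a b, G' (φ z) a b = G' (φ z) b a) (a b w : V) :
    koszulForm (fderiv ℝ G z) a b w =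
      koszulForm (fderiv ℝ G' (φ z)) (fderiv ℝ φ z a) (fderiv ℝ φ z b) (fderiv ℝ φ z w)
        + G' (φ z) (fderiv ℝ (fderiv ℝ φ) z a b) (fderiv ℝ φ z w) := by
  -- By symmetry of the second derivative, its six contributions to the Koszul combination cancel
  -- down to the single term in `a`, `b`.
  have hs : ∀ a b, fderiv ℝ (fderiv ℝ φ) z a b = fderiv ℝ (fderiv ℝ φ) z b a :=
    fun a b => (hφ.isSymmSndFDerivAt (by simpa using ENat.LEInfty.out)).eq a b
  rw [koszulForm_apply, koszulForm_apply, fderiv_pullback hG hG' hφ h, fderiv_pullback hG hG' hφ h,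
    fderiv_pullback hG hG' hφ h, hs b a, hs w a, hs w b,
    hsymm (fderiv ℝ φ z b) (fderiv ℝ (fderiv ℝ φ) z a w)]
  ring

lemma hasDerivWithinAt_fderiv_apply {φ : V → V} {u v : ℝ → V} {u' v' : V} {J : Set ℝ} {t : ℝ}
    (hφ : ContDiffAt ℝ ∞ φ (u t)) (hu : HasDerivAt u u' t) (hv : HasDerivWithinAt v v' J t) :
    HasDerivWithinAt (fun s => fderiv ℝ φ (u s) (v s))
      (fderiv ℝ (fderiv ℝ φ) (u t) u' (v t) + fderiv ℝ φ (u t) v') J t := by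
  have h2 : HasFDerivAt (fderiv ℝ φ) (fderiv ℝ (fderiv ℝ φ) (u t)) (u t) :=
    ((hφ.fderiv_right (m := ∞) (by simp)).differentiableAt (by simp)).hasFDerivAt
  exact (h2.comp_hasDerivWithinAt t hu.hasDerivWithinAt).clm_apply hv

end ChangeOfVariables

/-! ### Chart independence of the parallel equation. -/

section Parallel

variable {d : ℕ} {M : Type*} [TopologicalSpace M] [ChartedSpace (EuclideanSpace ℝ (Fin d)) M]
  [IsManifold (𝓡 d) ∞ M]
  [RiemannianBundle (fun x : M => TangentSpace (𝓡 d) x)]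

local notation "𝔼" => EuclideanSpace ℝ (Fin d)

lemma metricForm_transition {c c' : M} {y : 𝔼} (hy : y ∈ overlap c c') (a b : 𝔼) :
    metricForm c y a b = metricForm c' (transition c c' y) (fderiv ℝ (transition c c') y a)
      (fderiv ℝ (transition c c') y b) := by
  set x := (extChartAt (𝓡 d) c).symm y with hx
  have hxs : x ∈ (chartAt 𝔼 c).source := extChart_symm_mem hy.1
  have hxy : extChartAt (𝓡 d) c x = y := (extChartAt (𝓡 d) c).right_inv hy.1
  have key : ∀ a : 𝔼, fderiv ℝ (transition c c') y a = coord c' x (uncoord c x a) := fun a => by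
    rw [coord_change hxs hy.2, hxy, coord_uncoord hxs]
  rw [key, key]
  exact inner_eq_chartMetric hy.2 (uncoord c x a) (uncoord c x b)

/-- The equation of parallel fields at time `t` in the chart around `c`. -/
def ParallelEqAt (γ : ℝ → M) (V : (t : ℝ) → TangentSpace (𝓡 d) (γ t)) (J : Set ℝ) (t : ℝ)
    (c : M) : Prop :=
  ∃ V' : 𝔼, HasDerivWithinAt (fun s => coord c (γ s) (V s)) V' J t ∧
    ∀ w : 𝔼, chartMetric c (extChartAt (𝓡 d) c (γ t)) V' w +
      christoffel c (extChartAt (𝓡 d) c (γ t)) (coord c (γ t) (velocity γ t))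
        (coord c (γ t) (V t)) w = 0

variable [IsContMDiffRiemannianBundle (𝓡 d) ∞ (EuclideanSpace ℝ (Fin d))
      (fun x : M => TangentSpace (𝓡 d) x)]

lemma christoffel_transition {c c' : M} {y : 𝔼} (hy : y ∈ overlap c c') (a b w : 𝔼) :
    christoffel c y a b w = christoffel c' (transition c c' y)
      (fderiv ℝ (transition c c') y a) (fderiv ℝ (transition c c') y b)
      (fderiv ℝ (transition c c') y w) + metricForm c' (transition c c' y)
        (fderiv ℝ (fderiv ℝ (transition c c')) y a b) (fderiv ℝ (transition c c') y w) := by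
  have hy' : transition c c' y ∈ (extChartAt (𝓡 d) c').target := extChart_mem_target hy.2
  rw [← koszulForm_metricForm hy.1, ← koszulForm_metricForm hy']
  refine koszulForm_pullback (contDiffAt_metricForm hy.1) (contDiffAt_metricForm hy')
    ((contDiffOn_transition c c').contDiffAt ((isOpen_overlap c c').mem_nhds hy)) ?_
    (metricForm_symm c' _) a b w
  filter_upwards [(isOpen_overlap c c').mem_nhds hy] with q hq
  exact metricForm_transition hq

/-- The derivative of the new coordinates contains a second-derivative term of the transition map,
and the Christoffel symbols change by exactly the same term. Thus a solution in one chart solves the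
equation in every chart. -/
lemma ParallelEqAt.change {γ : ℝ → M} {V : (t : ℝ) → TangentSpace (𝓡 d) (γ t)} {J : Set ℝ}
    {t : ℝ} {c c' : M} (hγ : MDifferentiableAt 𝓘(ℝ, ℝ) (𝓡 d) γ t) (htJ : t ∈ J)
    (hc : γ t ∈ (chartAt 𝔼 c).source) (hc' : γ t ∈ (chartAt 𝔼 c').source)
    (h : ParallelEqAt γ V J t c) : ParallelEqAt γ V J t c' := by
  obtain ⟨V', hV', hw⟩ := h
  set y := extChartAt (𝓡 d) c (γ t) with hy
  have hyo : y ∈ overlap c c' := extChart_mem_overlap hc hc'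
  have hφ : ContDiffAt ℝ ∞ (transition (d := d) c c') y :=
    (contDiffOn_transition c c').contDiffAt ((isOpen_overlap c c').mem_nhds hyo)
  have h3 := hasDerivWithinAt_fderiv_apply hφ (hasDerivAt_extChart_comp hγ hc) hV'
  have hyt : transition c c' y = extChartAt (𝓡 d) c' (γ t) := by
    rw [transition, hy, extChart_left_inv hc]
  have hev : ∀ᶠ s in nhdsWithin t J, coord c' (γ s) (V s) =
      fderiv ℝ (transition c c') (extChartAt (𝓡 d) c (γ s)) (coord c (γ s) (V s)) := by
    have h5 : ∀ᶠ s in nhds t, γ s ∈ (chartAt 𝔼 c).source ∩ (chartAt 𝔼 c').source :=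
      hγ.continuousAt.eventually_mem
        (((chartAt 𝔼 c).open_source.inter (chartAt 𝔼 c').open_source).mem_nhds ⟨hc, hc'⟩)
    filter_upwards [nhdsWithin_le_nhds h5] with s hs
    exact coord_change hs.1 hs.2 _
  refine ⟨_, h3.congr_of_eventuallyEq hev (hev.self_of_nhdsWithin htJ), fun w' => ?_⟩
  -- The derivative of the transition map is onto, so it is enough to test against vectors in its
  -- range.
  obtain ⟨w, rfl⟩ : ∃ w, fderiv ℝ (transition c c') y w = w' :=
    ⟨coord c (γ t) (uncoord c' (γ t) w'), by rw [← coord_change hc hc', coord_uncoord hc']⟩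
  have h6 := hw w
  rw [christoffel_transition hyo, ← metricForm_apply, metricForm_transition hyo] at h6
  rw [coord_change hc hc', coord_change hc hc', ← hyt, ← metricForm_apply, map_add,
    add_apply]
  linarith

end Parallel

/-! ### Short-time linear ODEs and a product rule. -/

section LinearODE

variable {V : Type*} [NormedAddCommGroup V] [NormedSpace ℝ V]

/-- A linear differential equation has solutions on short intervals, whatever the initial value. -/
lemma exists_linearODE_solution [CompleteSpace V] {A : ℝ → V →L[ℝ] V} {a b K : ℝ} (hab : a ≤ b)
    (hA : ContinuousOn A (Icc a b)) (hK : ∀ t ∈ Icc a b, ‖A t‖ ≤ K) (hKab : K * (b - a) ≤ 1 / 2)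
    (y₀ : V) :
    ∃ y : ℝ → V, y a = y₀ ∧ ∀ t ∈ Icc a b, HasDerivWithinAt y (A t (y t)) (Icc a b) t := by
  have hK0 : 0 ≤ K := (norm_nonneg _).trans (hK a (left_mem_Icc.2 hab))
  have hR : 0 ≤ ‖y₀‖ + 1 := by positivity
  have hL : 0 ≤ K * (2 * ‖y₀‖ + 1) := by positivity
  -- On the ball of radius ‖y₀‖ + 1 about y₀ the speed is at most K(2‖y₀‖ + 1); in time 1/(2K) a
  -- solution moves at most ‖y₀‖ + 1/2 and stays inside.
  have hPL : IsPicardLindelof (fun t y => A t y) (⟨a, left_mem_Icc.2 hab⟩ : Icc a b) y₀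
      ⟨‖y₀‖ + 1, hR⟩ 0 ⟨K * (2 * ‖y₀‖ + 1), hL⟩ ⟨K, hK0⟩ := by
    refine ⟨fun t ht => ?_, fun y _ => hA.clm_apply continuousOn_const, fun t ht y hy => ?_, ?_⟩
    · exact ((A t).lipschitz.weaken (hK t ht)).lipschitzOnWith
    · have h1 : ‖y‖ ≤ 2 * ‖y₀‖ + 1 := by
        have h2 : dist y y₀ ≤ ‖y₀‖ + 1 := hy
        rw [dist_comm, dist_eq_norm] at h2
        have := norm_le_norm_add_norm_sub y₀ y
        linarith
      exact ((A t).le_opNorm y).trans (mul_le_mul (hK t ht) h1 (norm_nonneg _) hK0)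
    · have h1 : max (b - a) (a - a) = b - a := max_eq_left (by linarith)
      change K * (2 * ‖y₀‖ + 1) * max (b - a) (a - a) ≤ ‖y₀‖ + 1 - 0
      rw [h1]
      nlinarith [norm_nonneg y₀]
  exact hPL.exists_eq_forall_mem_Icc_hasDerivWithinAt₀

lemma hasDerivWithinAt_bilin_apply {G : V → V →L[ℝ] V →L[ℝ] ℝ} {u a b : ℝ → V} {u' a' b' : V}
    {J : Set ℝ} {t : ℝ} (hG : ContDiffAt ℝ ∞ G (u t)) (hu : HasDerivAt u u' t)
    (ha : HasDerivWithinAt a a' J t) (hb : HasDerivWithinAt b b' J t) :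
    HasDerivWithinAt (fun s => G (u s) (a s) (b s))
      (fderiv ℝ G (u t) u' (a t) (b t) + G (u t) a' (b t) + G (u t) (a t) b') J t := by
  have h2 : HasFDerivAt G (fderiv ℝ G (u t)) (u t) :=
    (hG.differentiableAt (by simp)).hasFDerivAt
  have h3 := ((h2.comp_hasDerivWithinAt t hu.hasDerivWithinAt).clm_apply ha).clm_apply hb
  simpa using h3

end LinearODE

/-! ### Existence, uniqueness and isometry of parallel fields. -/

section ParallelFields

variable {d : ℕ} {M : Type*} [TopologicalSpace M] [ChartedSpace (EuclideanSpace ℝ (Fin d)) M]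
  [IsManifold (𝓡 d) ∞ M]
  [RiemannianBundle (fun x : M => TangentSpace (𝓡 d) x)]

local notation "𝔼" => EuclideanSpace ℝ (Fin d)

lemma ParallelEqAt.congr_of_mem_nhdsWithin {γ : ℝ → M}
    {V W : (t : ℝ) → TangentSpace (𝓡 d) (γ t)} {J J' : Set ℝ} {t : ℝ} {c : M}
    (h : ParallelEqAt γ V J t c) (htJ : t ∈ J) (hVW : ∀ s ∈ J, W s = V s)
    (hJ : J ∈ nhdsWithin t J') : ParallelEqAt γ W J' t c := by
  obtain ⟨V', hV', hw⟩ := h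
  refine ⟨V', (hV'.congr (fun s hs => ?_) ?_).mono_of_mem_nhdsWithin hJ, fun w => ?_⟩
  · rw [hVW s hs]
  · rw [hVW t htJ]
  · rw [hVW t htJ]; exact hw w

/-- Nondegeneracy of the metric lets the equation determine the derivative, so the derivatives along
the two sets agree. This is what makes gluing possible at the junction. -/
lemma ParallelEqAt.union {γ : ℝ → M}
    {V : (t : ℝ) → TangentSpace (𝓡 d) (γ t)} {J J' : Set ℝ} {t : ℝ} {c : M}
    (hc : γ t ∈ (chartAt 𝔼 c).source)
    (h : ParallelEqAt γ V J t c) (h' : ParallelEqAt γ V J' t c) :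
    ParallelEqAt γ V (J ∪ J') t c := by
  obtain ⟨V₁, hV₁, hw₁⟩ := h
  obtain ⟨V₂, hV₂, hw₂⟩ := h'
  have hV : V₁ = V₂ := by
    rw [← sub_eq_zero]
    refine metricForm_pos (extChart_mem_target hc) ?_
    have h1 := hw₁ (V₁ - V₂)
    have h2 := hw₂ (V₁ - V₂)
    rw [← metricForm_apply] at h1 h2
    have h3 : metricForm c (extChartAt (𝓡 d) c (γ t)) (V₁ - V₂) (V₁ - V₂) =
        metricForm c (extChartAt (𝓡 d) c (γ t)) V₁ (V₁ - V₂) -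
          metricForm c (extChartAt (𝓡 d) c (γ t)) V₂ (V₁ - V₂) := by
      rw [← sub_apply, ← map_sub]
    linarith
  subst hV
  exact ⟨V₁, hV₁.union hV₂, hw₁⟩

lemma IsParallelOn.glue {γ : ℝ → M} {V W : (t : ℝ) → TangentSpace (𝓡 d) (γ t)} {a b e : ℝ}
    (hab : a ≤ b) (hbe : b ≤ e) (hV : IsParallelOn γ V (Icc a b))
    (hW : IsParallelOn γ W (Icc b e)) (hVW : V b = W b) :
    IsParallelOn γ (fun s => if s ≤ b then V s else W s) (Icc a e) := by
  have h1 : ∀ s ∈ Icc a b, (if s ≤ b then V s else W s) = V s := fun s hs => if_pos hs.2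
  have h2 : ∀ s ∈ Icc b e, (if s ≤ b then V s else W s) = W s := by
    intro s hs
    rcases hs.1.eq_or_lt with h | h
    · subst h; rw [if_pos le_rfl, hVW]
    · exact if_neg (not_le.2 h)
  intro t ht c hc
  rcases lt_trichotomy t b with h | h | h
  · have htJ : t ∈ Icc a b := ⟨ht.1, h.le⟩
    refine ParallelEqAt.congr_of_mem_nhdsWithin (hV t htJ c hc) htJ h1 ?_
    filter_upwards [self_mem_nhdsWithin, nhdsWithin_le_nhds (Iio_mem_nhds h)] with s hs hs'
    exact ⟨hs.1, hs'.le⟩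
  · subst h
    have htJ : t ∈ Icc a t := ⟨ht.1, le_rfl⟩
    have htJ' : t ∈ Icc t e := ⟨le_rfl, ht.2⟩
    have := ParallelEqAt.union hc
      (ParallelEqAt.congr_of_mem_nhdsWithin (hV t htJ c hc) htJ h1 self_mem_nhdsWithin)
      (ParallelEqAt.congr_of_mem_nhdsWithin (hW t htJ' c hc) htJ' h2 self_mem_nhdsWithin)
    rwa [Icc_union_Icc_eq_Icc hab hbe] at this
  · have htJ : t ∈ Icc b e := ⟨h.le, ht.2⟩
    refine ParallelEqAt.congr_of_mem_nhdsWithin (hW t htJ c hc) htJ h2 ?_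
    filter_upwards [self_mem_nhdsWithin, nhdsWithin_le_nhds (Ioi_mem_nhds h)] with s hs hs'
    exact ⟨hs'.le, hs.2⟩

lemma IsParallelOn.mono {γ : ℝ → M} {V : (t : ℝ) → TangentSpace (𝓡 d) (γ t)} {J J' : Set ℝ}
    (h : IsParallelOn γ V J) (hJ : J' ⊆ J) : IsParallelOn γ V J' := fun t ht c hc =>
  let ⟨V', hV', hw⟩ := h t (hJ ht) c hc
  ⟨V', hV'.mono hJ, hw⟩

variable [IsContMDiffRiemannianBundle (𝓡 d) ∞ (EuclideanSpace ℝ (Fin d))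
      (fun x : M => TangentSpace (𝓡 d) x)]

lemma IsParallelOn.add_smul {γ : ℝ → M} {V W : (t : ℝ) → TangentSpace (𝓡 d) (γ t)} {J : Set ℝ}
    (hV : IsParallelOn γ V J) (r : ℝ) (hW : IsParallelOn γ W J) :
    IsParallelOn γ (fun s => V s + r • W s) J := by
  intro t ht c hc
  obtain ⟨V', hV', hw⟩ := hV t ht c hc
  obtain ⟨W', hW', hw'⟩ := hW t ht c hc
  refine ⟨V' + r • W', ?_, fun w => ?_⟩
  · simp only [coord_add, coord_smul]
    exact hV'.add (hW'.const_smul r)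
  · have h1 := hw w
    have h2 := hw' w
    simp only [← koszulForm_metricForm (extChart_mem_target hc), ← metricForm_apply, coord_add,
      coord_smul, map_add, map_smul, add_apply, smul_apply, smul_eq_mul] at h1 h2 ⊢
    linear_combination h1 + r * h2

/-- The derivative of the metric along the curve is a sum of two Christoffel terms, which cancel
those coming from the derivatives of the two fields. -/
lemma hasDerivWithinAt_inner_of_parallel {γ : ℝ → M} {V W : (t : ℝ) → TangentSpace (𝓡 d) (γ t)}
    {J : Set ℝ} {t : ℝ} (hγ : MDifferentiableAt 𝓘(ℝ, ℝ) (𝓡 d) γ t) (htJ : t ∈ J)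
    (hV : IsParallelOn γ V J) (hW : IsParallelOn γ W J) :
    HasDerivWithinAt (fun s => inner ℝ (V s) (W s)) 0 J t := by
  have hc : γ t ∈ (chartAt 𝔼 (γ t)).source := mem_chart_source _ _
  have hz : extChartAt (𝓡 d) (γ t) (γ t) ∈ (extChartAt (𝓡 d) (γ t)).target :=
    extChart_mem_target hc
  obtain ⟨V', hV', hw⟩ := hV t htJ _ hc
  obtain ⟨W', hW', hw'⟩ := hW t htJ _ hc
  have h1 := hasDerivWithinAt_bilin_apply (contDiffAt_metricForm hz)
    (hasDerivAt_extChart_comp hγ hc) hV' hW'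
  rw [← christoffel_add_swap hz] at h1
  have h2 := hw (coord (γ t) (γ t) (W t))
  have h3 := hw' (coord (γ t) (γ t) (V t))
  rw [← metricForm_apply] at h2 h3
  rw [metricForm_symm] at h3
  have hev : ∀ᶠ s in nhdsWithin t J, inner ℝ (V s) (W s) =
      metricForm (γ t) (extChartAt (𝓡 d) (γ t) (γ s)) (coord (γ t) (γ s) (V s))
        (coord (γ t) (γ s) (W s)) := by
    have h5 : ∀ᶠ s in nhds t, γ s ∈ (chartAt 𝔼 (γ t)).source :=
      hγ.continuousAt.eventually_mem ((chartAt 𝔼 (γ t)).open_source.mem_nhds hc)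
    filter_upwards [nhdsWithin_le_nhds h5] with s hs
    exact inner_eq_chartMetric hs _ _
  convert! h1.congr_of_eventuallyEq hev (hev.self_of_nhdsWithin htJ) using 1
  linarith

lemma IsParallelOn.inner_eq {γ : ℝ → M} {V W : (t : ℝ) → TangentSpace (𝓡 d) (γ t)}
    {a b t : ℝ} (hγ : MDifferentiable 𝓘(ℝ, ℝ) (𝓡 d) γ) (hV : IsParallelOn γ V (Icc a b))
    (hW : IsParallelOn γ W (Icc a b)) (ht : t ∈ Icc a b) :
    inner ℝ (V t) (W t) = inner ℝ (V a) (W a) := by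
  have h : ∀ s ∈ Icc a b, HasDerivWithinAt (fun s => inner ℝ (V s) (W s)) 0 (Icc a b) s :=
    fun s hs => hasDerivWithinAt_inner_of_parallel (hγ s) hs hV hW
  refine constant_of_derivWithin_zero (f := fun s => inner ℝ (V s) (W s))
    (fun s hs => (h s hs).differentiableWithinAt) (fun s hs => ?_) t ht
  exact (h s (Ico_subset_Icc_self hs)).derivWithin
    ((uniqueDiffOn_Icc (hs.1.trans_lt hs.2)) s (Ico_subset_Icc_self hs))

/-- The difference is parallel, hence of constant norm, and it vanishes at the left end. -/
lemma IsParallelOn.eq_of_eq {γ : ℝ → M} {V W : (t : ℝ) → TangentSpace (𝓡 d) (γ t)}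
    {a b t : ℝ} (hγ : MDifferentiable 𝓘(ℝ, ℝ) (𝓡 d) γ) (hV : IsParallelOn γ V (Icc a b))
    (hW : IsParallelOn γ W (Icc a b)) (h : V a = W a) (ht : t ∈ Icc a b) : V t = W t := by
  have h1 := hV.add_smul (-1) hW
  have h2 := IsParallelOn.inner_eq hγ h1 h1 ht
  simp only [h, neg_smul, one_smul, add_neg_cancel, inner_zero_left, inner_self_eq_zero] at h2
  exact add_neg_eq_zero.1 h2

/-- The operator of the equation of parallel fields along `γ` in the chart around `c`. -/
def parallelOperator (γ : ℝ → M) (c : M) (t : ℝ) : 𝔼 →L[ℝ] 𝔼 :=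
  -(metricInv c (extChartAt (𝓡 d) c (γ t))).comp
    (koszulForm (fderiv ℝ (metricForm c) (extChartAt (𝓡 d) c (γ t)))
      (deriv (fun s => extChartAt (𝓡 d) c (γ s)) t))

lemma continuousAt_parallelOperator {γ : ℝ → M} (hγ : ContMDiff 𝓘(ℝ, ℝ) (𝓡 d) ∞ γ) {c : M} {t : ℝ}
    (hc : γ t ∈ (chartAt 𝔼 c).source) :
    ContinuousAt (parallelOperator (d := d) γ c) t := by
  have h1 : ContMDiffAt 𝓘(ℝ, ℝ) 𝓘(ℝ, 𝔼) ∞ (fun s => extChartAt (𝓡 d) c (γ s)) t :=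
    (contMDiffAt_extChartAt' hc).comp t (hγ t)
  have h2 : ContDiffAt ℝ ∞ (fun s => extChartAt (𝓡 d) c (γ s)) t := h1.contDiffAt
  have h3 : ContinuousAt (deriv (fun s => extChartAt (𝓡 d) c (γ s))) t :=
    (h2.continuousAt_fderiv (by simp)).clm_apply continuousAt_const
  have hz := extChart_mem_target hc
  have h4 := ContinuousAt.comp (f := fun s => (extChartAt (𝓡 d) c (γ s),
    deriv (fun s => extChartAt (𝓡 d) c (γ s)) s))
    (ContDiffAt.continuousAt_koszulForm (contDiffAt_metricForm hz) _) (h2.continuousAt.prodMk h3)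
  have h5 := ContinuousAt.comp (f := fun s => extChartAt (𝓡 d) c (γ s))
    (continuousAt_metricInv hz) h2.continuousAt
  exact (h5.clm_comp h4).neg

/-- The size ε must depend neither on the subinterval nor on the initial vector, since each piece of
the later gluing starts where the previous one ended. Linearity of the ODE permits this. -/
lemma exists_isParallelOn_nhds {γ : ℝ → M} (hγ : ContMDiff 𝓘(ℝ, ℝ) (𝓡 d) ∞ γ) (t₀ : ℝ) :
    ∃ ε > 0, ∀ a b, a ≤ b → Icc a b ⊆ Metric.ball t₀ ε → ∀ w : TangentSpace (𝓡 d) (γ a),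
      ∃ V : (t : ℝ) → TangentSpace (𝓡 d) (γ t), IsParallelOn γ V (Icc a b) ∧ V a = w := by
  have hγd : MDifferentiable 𝓘(ℝ, ℝ) (𝓡 d) γ := hγ.mdifferentiable (by simp)
  set c := γ t₀
  have hc : γ t₀ ∈ (chartAt 𝔼 c).source := mem_chart_source _ _
  have h1 : ∀ᶠ s in nhds t₀, γ s ∈ (chartAt 𝔼 c).source :=
    hγ.continuous.continuousAt.eventually_mem ((chartAt 𝔼 c).open_source.mem_nhds hc)
  have h2 : ∀ᶠ s in nhds t₀, ‖parallelOperator (d := d) γ c s‖ <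
      ‖parallelOperator (d := d) γ c t₀‖ + 1 :=
    (continuousAt_parallelOperator hγ hc).norm.eventually_lt_const (lt_add_one _)
  obtain ⟨δ, hδ, hball⟩ := Metric.eventually_nhds_iff_ball.1 (h1.and h2)
  set K := ‖parallelOperator (d := d) γ c t₀‖ + 1
  have hK : 0 < K := by positivity
  -- A ball of radius 1/(4K) contains only intervals of length at most 1/(2K), as the short-time
  -- existence theorem demands.
  refine ⟨min δ (1 / (4 * K)), by positivity, fun a b hab hsub w => ?_⟩
  have hsub' : ∀ t ∈ Icc a b, t ∈ Metric.ball t₀ δ := fun t ht =>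
    Metric.ball_subset_ball (min_le_left _ _) (hsub ht)
  have hlen : K * (b - a) ≤ 1 / 2 := by
    have h3 := Metric.ball_subset_ball (min_le_right _ _) (hsub (left_mem_Icc.2 hab))
    have h4 := Metric.ball_subset_ball (min_le_right _ _) (hsub (right_mem_Icc.2 hab))
    rw [Metric.mem_ball, Real.dist_eq, abs_lt] at h3 h4
    have h5 : b - a ≤ 2 * (1 / (4 * K)) := by linarith [h3.1, h4.2]
    calc K * (b - a) ≤ K * (2 * (1 / (4 * K))) := by gcongr
      _ = 1 / 2 := by field_simp; norm_num
  obtain ⟨y, hy0, hy⟩ := exists_linearODE_solution hab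
    (fun t ht => (continuousAt_parallelOperator hγ (hball t (hsub' t ht)).1).continuousWithinAt)
    (fun t ht => (hball t (hsub' t ht)).2.le) hlen (coord c (γ a) w)
  refine ⟨fun t => uncoord c (γ t) (y t), fun t ht c' hc' => ?_, ?_⟩
  · have hct := (hball t (hsub' t ht)).1
    have hz := extChart_mem_target hct
    refine ParallelEqAt.change (hγd t) ht hct hc' ⟨parallelOperator γ c t (y t), ?_, fun v => ?_⟩
    · exact (hy t ht).congr (fun s hs => coord_uncoord (hball s (hsub' s hs)).1 _)
        (coord_uncoord hct _)
    · rw [coord_uncoord hct, ← metricForm_apply, parallelOperator,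
        (hasDerivAt_extChart_comp (hγd t) hct).deriv, neg_apply, map_neg, neg_apply,
        ContinuousLinearMap.comp_apply, metricForm_metricInv hz, koszulForm_metricForm hz]
      ring
  · simp only [hy0]
    exact uncoord_coord (hball a (hsub' a (left_mem_Icc.2 hab))).1 w

/-- Compactness of the interval gives a finite partition subordinate to the local existence balls;
the field is extended piece by piece. -/
lemma exists_isParallelOn {γ : ℝ → M} (hγ : ContMDiff 𝓘(ℝ, ℝ) (𝓡 d) ∞ γ) {a b : ℝ} (hab : a ≤ b)
    (w : TangentSpace (𝓡 d) (γ a)) :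
    ∃ V : (t : ℝ) → TangentSpace (𝓡 d) (γ t), IsParallelOn γ V (Icc a b) ∧ V a = w := by
  choose ε hε hloc using exists_isParallelOn_nhds hγ
  obtain ⟨t, ht0, htm, ⟨m, hm⟩, hsub⟩ := exists_monotone_Icc_subset_open_cover_Icc hab
    (c := fun i : ℝ => {s : Icc a b | (s : ℝ) ∈ Metric.ball i (ε i)})
    (fun i => Metric.isOpen_ball.preimage continuous_subtype_val)
    (fun s _ => mem_iUnion.2 ⟨s, Metric.mem_ball_self (hε _)⟩)
  have key : ∀ n, ∃ V : (t : ℝ) → TangentSpace (𝓡 d) (γ t),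
      IsParallelOn γ V (Icc a (t n)) ∧ V a = w := by
    intro n
    induction n with
    | zero =>
      refine hloc a a (t 0) (by rw [ht0]) ?_ w
      rw [ht0, Icc_self, singleton_subset_iff]
      exact Metric.mem_ball_self (hε _)
    | succ n ih =>
      obtain ⟨V, hV, hVa⟩ := ih
      obtain ⟨i, hi⟩ := hsub n
      have hle : (t n : ℝ) ≤ t (n + 1) := htm n.le_succ
      obtain ⟨W, hW, hWa⟩ := hloc i (t n) (t (n + 1)) hle
        (fun s hs => hi (show (⟨s, (t n).2.1.trans hs.1, hs.2.trans (t (n + 1)).2.2⟩ : Icc a b) ∈ _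
          from ⟨hs.1, hs.2⟩)) (V (t n))
      exact ⟨_, hV.glue (t n).2.1 hle hW hWa.symm, by rw [if_pos (t n).2.1, hVa]⟩
  have := key m
  rwa [hm m le_rfl] at this

end ParallelFields

/-! ### Parallel transport as an isometry, and the descent inequality. -/

section Transport

variable {d : ℕ} {M : Type*} [TopologicalSpace M] [ChartedSpace (EuclideanSpace ℝ (Fin d)) M]
  [IsManifold (𝓡 d) ∞ M]
  [RiemannianBundle (fun x : M => TangentSpace (𝓡 d) x)]
  [IsContMDiffRiemannianBundle (𝓡 d) ∞ (EuclideanSpace ℝ (Fin d))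
      (fun x : M => TangentSpace (𝓡 d) x)]

/-- `transport` is defined by an arbitrary choice of parallel field; uniqueness makes the choice
irrelevant. -/
lemma transport_eq {γ : ℝ → M} (hγ : ContMDiff 𝓘(ℝ, ℝ) (𝓡 d) ∞ γ)
    {V : (t : ℝ) → TangentSpace (𝓡 d) (γ t)} (hV : IsParallelOn γ V (Icc 0 1)) :
    transport γ (γ 0) (V 0) = V 1 := by
  have hex : ∃ W : (t : ℝ) → TangentSpace (𝓡 d) (γ t), IsParallelOn γ W (Icc 0 1) ∧
      (⟨γ 0, W 0⟩ : TangentBundle (𝓡 d) M) = (⟨γ 0, V 0⟩ : TangentBundle (𝓡 d) M) :=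
    ⟨V, hV, rfl⟩
  rw [transport, dif_pos hex]
  have h := hex.choose_spec
  have h0 : hex.choose 0 = V 0 := by simpa using h.2
  exact h.1.eq_of_eq (hγ.mdifferentiable (by simp)) hV h0 (right_mem_Icc.2 zero_le_one)

lemma transport_add_smul {γ : ℝ → M} (hγ : ContMDiff 𝓘(ℝ, ℝ) (𝓡 d) ∞ γ) {x : M} (hx : γ 0 = x)
    (v w : TangentSpace (𝓡 d) x) (r : ℝ) :
    transport γ x (v + r • w) = transport γ x v + r • transport γ x w := by
  subst hx
  obtain ⟨V, hV, rfl⟩ := exists_isParallelOn hγ zero_le_one v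
  obtain ⟨W, hW, rfl⟩ := exists_isParallelOn hγ zero_le_one w
  rw [transport_eq hγ hV, transport_eq hγ hW]
  exact transport_eq hγ (hV.add_smul r hW)

lemma norm_transport {γ : ℝ → M} (hγ : ContMDiff 𝓘(ℝ, ℝ) (𝓡 d) ∞ γ) {x : M} (hx : γ 0 = x)
    (v : TangentSpace (𝓡 d) x) : ‖transport γ x v‖ = ‖v‖ := by
  subst hx
  obtain ⟨V, hV, rfl⟩ := exists_isParallelOn hγ zero_le_one v
  have h := hV.inner_eq (hγ.mdifferentiable (by simp)) hV (right_mem_Icc.2 zero_le_one)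
  rw [transport_eq hγ hV, norm_eq_sqrt_real_inner, norm_eq_sqrt_real_inner, h]

lemma velocity_comp_mul {γ : ℝ → M} (hγ : MDifferentiable 𝓘(ℝ, ℝ) (𝓡 d) γ) (r t : ℝ) :
    velocity (d := d) (fun s => γ (r * s)) t = r • velocity (d := d) γ (r * t) := by
  have h1 : HasFDerivAt (fun s : ℝ => r * s) (r • ContinuousLinearMap.id ℝ ℝ) t := by
    have := (ContinuousLinearMap.id ℝ ℝ).hasFDerivAt.const_mul (x := t) r
    exact this
  have h2 := (hγ (r * t)).hasMFDerivAt.comp (x := t) (f := fun s : ℝ => r * s) h1.hasMFDerivAt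
  have h3 : mfderiv 𝓘(ℝ, ℝ) (𝓡 d) (fun s => γ (r * s)) t = _ := h2.mfderiv
  rw [velocity, h3]
  change mfderiv 𝓘(ℝ, ℝ) (𝓡 d) γ (r * t) (r • (1 : ℝ)) = _
  exact map_smul (mfderiv 𝓘(ℝ, ℝ) (𝓡 d) γ (r * t)) r (1 : ℝ)

lemma IsParallelOn.comp_mul {γ : ℝ → M} {V : (t : ℝ) → TangentSpace (𝓡 d) (γ t)} {J J' : Set ℝ}
    (hγ : MDifferentiable 𝓘(ℝ, ℝ) (𝓡 d) γ) (hV : IsParallelOn γ V J) {r : ℝ}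
    (hr : MapsTo (fun s => r * s) J' J) :
    IsParallelOn (fun s => γ (r * s)) (fun s => V (r * s)) J' := by
  intro t ht c hc
  obtain ⟨V', hV', hw⟩ := hV (r * t) (hr ht) c hc
  have h1 : HasDerivWithinAt (fun s : ℝ => r * s) r J' t := by
    simpa using (hasDerivWithinAt_id t J').const_mul r
  refine ⟨r • V', HasDerivWithinAt.scomp t hV' h1 hr, fun w => ?_⟩
  have h2 := hw w
  rw [velocity_comp_mul hγ, coord_smul]
  simp only [← koszulForm_metricForm (extChart_mem_target hc), ← metricForm_apply,
    koszulForm_apply, map_smul, smul_apply, smul_eq_mul] at h2 ⊢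
  linear_combination r * h2

lemma IsGeodesic.comp_mul {γ : ℝ → M} (hγ : IsGeodesic d γ) (r : ℝ) :
    IsGeodesic d (fun s => γ (r * s)) := by
  have hd : MDifferentiable 𝓘(ℝ, ℝ) (𝓡 d) γ := hγ.1.mdifferentiable (by simp)
  refine ⟨hγ.1.comp (contDiff_const.mul contDiff_id).contMDiff, ?_⟩
  have h1 := hγ.2.comp_mul hd (mapsTo_univ (fun s => r * s) univ)
  -- The velocity of the rescaled curve is r times the rescaled velocity field, written here as V +
  -- (r - 1)V.
  have h2 := h1.add_smul (r - 1) h1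
  convert! h2 using 2 with s
  rw [velocity_comp_mul hd]
  module

lemma inner_grad (f : M → ℝ) (x : M) (v : TangentSpace (𝓡 d) x) :
    inner ℝ (grad f x) v = mfderiv (𝓡 d) 𝓘(ℝ, ℝ) f x v := by
  have : FiniteDimensional ℝ (TangentSpace (𝓡 d) x) :=
    inferInstanceAs (FiniteDimensional ℝ (EuclideanSpace ℝ (Fin d)))
  have : CompleteSpace (TangentSpace (𝓡 d) x) := FiniteDimensional.complete ℝ _
  let φ : TangentSpace (𝓡 d) x →L[ℝ] ℝ := mfderiv (𝓡 d) 𝓘(ℝ, ℝ) f x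
  exact InnerProductSpace.toDual_symm_apply (𝕜 := ℝ) (x := v) (y := φ)

lemma grad_average {n : ℕ} {f : Fin n → M → ℝ} {x : M}
    (hf : ∀ i, MDifferentiableAt (𝓡 d) 𝓘(ℝ, ℝ) (f i) x) :
    grad (d := d) (average f) x = (n : ℝ)⁻¹ • ∑ i, grad (f i) x := by
  have h1 := (HasMFDerivAt.sum (t := Finset.univ) fun i _ => (hf i).hasMFDerivAt).const_smul
    ((n : ℝ)⁻¹)
  have h2 : ((n : ℝ)⁻¹ • ∑ i, f i) = average f := by
    ext y
    simp [average]
  rw [h2] at h1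
  refine ext_inner_right ℝ fun v => ?_
  rw [inner_grad, h1.mfderiv, real_inner_smul_left, sum_inner]
  simp_rw [inner_grad]
  let φ : Fin n → TangentSpace (𝓡 d) x →L[ℝ] ℝ := fun i => mfderiv (𝓡 d) 𝓘(ℝ, ℝ) (f i) x
  change (n : ℝ)⁻¹ * ((∑ i, φ i) v) = (n : ℝ)⁻¹ * ∑ i, φ i v
  rw [sum_apply]

/-- Smoothness speaks only of the endpoints, so it is applied to the slowed geodesic s ↦ γ(ts),
which reaches γ(t) at time 1 with initial velocity tγ'(0). -/
lemma GSmooth.norm_grad_sub_le {L : ℝ} {f : M → ℝ} (hf : GSmooth (d := d) L f) {γ : ℝ → M}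
    (hγ : IsGeodesic d γ) {V : (t : ℝ) → TangentSpace (𝓡 d) (γ t)}
    (hV : IsParallelOn γ V (Icc 0 1)) (hV0 : V 0 = grad f (γ 0)) {t : ℝ} (ht : t ∈ Icc (0 : ℝ) 1) :
    ‖grad f (γ t) - V t‖ ≤ L * (t * ‖velocity (d := d) γ 0‖) := by
  have hd : MDifferentiable 𝓘(ℝ, ℝ) (𝓡 d) γ := hγ.1.mdifferentiable (by simp)
  have hγ' := hγ.comp_mul t
  have hW : IsParallelOn (fun s => γ (t * s)) (fun s => V (t * s)) (Icc 0 1) :=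
    hV.comp_mul hd fun s hs => ⟨mul_nonneg ht.1 hs.1, mul_le_one₀ ht.2 hs.1 hs.2⟩
  have h0 : ∀ s, s = 0 → grad f (γ s) = V s := by
    rintro s rfl
    exact hV0.symm
  have h1 := hf.2 _ hγ'
  have h2 := transport_eq hγ'.1 hW
  rw [h0 (t * 0) (mul_zero t), h2, velocity_comp_mul hd, norm_smul, Real.norm_of_nonneg ht.1] at h1
  have h3 : ∀ s, s = t → ‖grad f (γ s) - V s‖ = ‖grad f (γ t) - V t‖ := by
    rintro s rfl
    rfl
  have h4 : ∀ s, s = 0 → ‖velocity (d := d) γ s‖ = ‖velocity (d := d) γ 0‖ := by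
    rintro s rfl
    rfl
  rwa [h3 _ (mul_one t), h4 _ (mul_zero t)] at h1

/-- With V the parallel field extending the initial gradient, ⟨V, γ'⟩ and ‖γ'‖ are constant, so the
derivative of f ∘ γ exceeds its initial value by at most Lt‖γ'(0)‖². Comparison with a quadratic
avoids integrating the derivative. -/
lemma GSmooth.le_of_isGeodesic {L : ℝ} {f : M → ℝ} (hf : GSmooth (d := d) L f) {γ : ℝ → M}
    (hγ : IsGeodesic d γ) :
    f (γ 1) ≤ f (γ 0) + inner ℝ (grad (d := d) f (γ 0)) (velocity γ 0)
      + L / 2 * ‖velocity (d := d) γ 0‖ ^ 2 := by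
  have hd : MDifferentiable 𝓘(ℝ, ℝ) (𝓡 d) γ := hγ.1.mdifferentiable (by simp)
  obtain ⟨V, hV, hV0⟩ := exists_isParallelOn hγ.1 zero_le_one (grad (d := d) f (γ 0))
  have hvel : IsParallelOn γ (velocity γ) (Icc 0 1) := hγ.2.mono (subset_univ _)
  have hderiv : ∀ t, HasDerivAt (fun s => f (γ s)) (inner ℝ (grad (d := d) f (γ t)) (velocity γ t)) t := by
    intro t
    have h1 := (hf.1 (γ t)).hasMFDerivAt.comp t (hd t).hasMFDerivAt
    let D : ℝ →L[ℝ] ℝ := (mfderiv (𝓡 d) 𝓘(ℝ, ℝ) f (γ t)).comp (mfderiv 𝓘(ℝ, ℝ) (𝓡 d) γ t)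
    have h2 : HasFDerivAt (fun s => f (γ s)) D t := h1.hasFDerivAt
    rw [inner_grad]
    exact h2.hasDerivAt
  have hbound : ∀ t ∈ Icc (0 : ℝ) 1, inner ℝ (grad (d := d) f (γ t)) (velocity γ t) ≤
      inner ℝ (grad (d := d) f (γ 0)) (velocity γ 0) + L * t * ‖velocity (d := d) γ 0‖ ^ 2 := by
    intro t ht
    have h1 : ‖velocity (d := d) γ t‖ = ‖velocity (d := d) γ 0‖ := by
      rw [norm_eq_sqrt_real_inner, norm_eq_sqrt_real_inner, hvel.inner_eq hd hvel ht]
    have h2 := hV.inner_eq hd hvel ht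
    rw [hV0] at h2
    have h3 := real_inner_le_norm (grad (d := d) f (γ t) - V t) (velocity γ t)
    have h4 := mul_le_mul_of_nonneg_right (hf.norm_grad_sub_le hγ hV hV0 ht)
      (norm_nonneg (velocity (d := d) γ t))
    rw [inner_sub_left, h2] at h3
    rw [h1] at h3 h4
    nlinarith
  have hB : ∀ t : ℝ, HasDerivAt (fun t => f (γ 0) + t * inner ℝ (grad (d := d) f (γ 0)) (velocity γ 0)
      + L / 2 * t ^ 2 * ‖velocity (d := d) γ 0‖ ^ 2)
      (inner ℝ (grad (d := d) f (γ 0)) (velocity γ 0) + L * t * ‖velocity (d := d) γ 0‖ ^ 2) t := by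
    intro t
    have h1 := (((hasDerivAt_id t).mul_const (inner ℝ (grad (d := d) f (γ 0)) (velocity γ 0))).const_add
      (f (γ 0))).add (((hasDerivAt_pow 2 t).const_mul (L / 2)).mul_const
        (‖velocity (d := d) γ 0‖ ^ 2))
    convert! h1 using 1
    push_cast
    ring
  have h := image_le_of_deriv_right_le_deriv_boundary (a := 0) (b := 1)
    (fun t _ => (hderiv t).continuousAt.continuousWithinAt)
    (fun t _ => (hderiv t).hasDerivWithinAt) (by simp)
    (fun t _ => (hB t).continuousAt.continuousWithinAt) (fun t _ => (hB t).hasDerivWithinAt)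
    (fun t ht => hbound t (Ico_subset_Icc_self ht)) (right_mem_Icc.2 zero_le_one)
  linarith

lemma IsGeodesicFrom.gSmooth_le {L : ℝ} {f : M → ℝ} (hf : GSmooth (d := d) L f) {x : M}
    {v : TangentSpace (𝓡 d) x} {γ : ℝ → M} (hγ : IsGeodesicFrom x v γ) :
    f (γ 1) ≤ f x + inner ℝ (grad f x) v + L / 2 * ‖v‖ ^ 2 ∧
      ‖grad (d := d) f (γ 1) - transport γ x (grad f x)‖ ≤ L * ‖v‖ := by
  obtain ⟨h, h0⟩ := hγ
  obtain ⟨rfl, h2⟩ := TotalSpace.mk.injEq .. ▸ h0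
  obtain rfl := eq_of_heq h2
  exact ⟨hf.le_of_isGeodesic h, hf.2 γ h⟩

lemma isGeodesicFrom_geodesic (hM : GeodesicallyComplete d M) (x : M) (v : TangentSpace (𝓡 d) x) :
    IsGeodesicFrom x v (geodesic x v) := by
  rw [geodesic, dif_pos (hM x v)]
  exact (hM x v).choose_spec

lemma IsGeodesicFrom.zero {x : M} {v : TangentSpace (𝓡 d) x} {γ : ℝ → M}
    (hγ : IsGeodesicFrom x v γ) : γ 0 = x := congrArg TotalSpace.proj hγ.2

/-- Parallel transport along the geodesic `t ↦ Exp_x(t v)` as a linear isometry. -/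
def expTransportₗᵢ (hM : GeodesicallyComplete d M) (x : M) (v : TangentSpace (𝓡 d) x) :
    TangentSpace (𝓡 d) x →ₗᵢ[ℝ] TangentSpace (𝓡 d) (expMap x v) where
  toFun := expTransport x v
  map_add' a b := by
    have h := isGeodesicFrom_geodesic hM x v
    have h1 := transport_add_smul h.1.1 h.zero a b 1
    rw [one_smul, one_smul] at h1
    exact h1
  map_smul' r a := by
    have h := isGeodesicFrom_geodesic hM x v
    -- Transporting a - a shows that zero goes to zero, which leaves homogeneity in the rule for v +
    -- r • w.
    have h0 := transport_add_smul h.1.1 h.zero a a (-1)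
    have h1 := transport_add_smul h.1.1 h.zero (a + (-1 : ℝ) • a) a r
    rw [h0] at h1
    simp only [neg_smul, one_smul, add_neg_cancel, zero_add] at h1
    exact h1
  norm_map' a := by
    have h := isGeodesicFrom_geodesic hM x v
    exact norm_transport h.1.1 h.zero a

lemma GSmooth.expMap_le (hM : GeodesicallyComplete d M) {L : ℝ} {f : M → ℝ}
    (hf : GSmooth (d := d) L f) (x : M) (v : TangentSpace (𝓡 d) x) :
    f (expMap x v) ≤ f x + inner ℝ (grad f x) v + L / 2 * ‖v‖ ^ 2 :=
  ((isGeodesicFrom_geodesic hM x v).gSmooth_le hf).1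

lemma GSmooth.norm_grad_expMap_sub_le (hM : GeodesicallyComplete d M) {L : ℝ} {f : M → ℝ}
    (hf : GSmooth (d := d) L f) (x : M) (v : TangentSpace (𝓡 d) x) :
    ‖grad f (expMap x v) - expTransport x v (grad f x)‖ ≤ L * ‖v‖ :=
  ((isGeodesicFrom_geodesic hM x v).gSmooth_le hf).2

end Transport

/-! ### Second moment of a sum of independent centred vectors. -/

section Variance

variable {H : Type*} [NormedAddCommGroup H] [InnerProductSpace ℝ H] [CompleteSpace H]
  {S : Type*} [MeasurableSpace S]

/-- The second moment of a sum of independent centred random vectors and a constant. -/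
lemma lintegral_norm_sq_const_add_sum (ν : Measure S) [IsProbabilityMeasure ν] {n : ℕ}
    {ξ : Fin n → S → H} (hint : ∀ i, Integrable (ξ i) ν)
    (hsq : ∀ i, Integrable (fun s => ‖ξ i s‖ ^ 2) ν) (hmean : ∀ i, ∫ s, ξ i s ∂ν = 0) (v : H) :
    ∫⁻ s, ENNReal.ofReal (‖v + ∑ i, ξ i (s i)‖ ^ 2) ∂(Measure.pi fun _ : Fin n => ν) =
      ENNReal.ofReal (‖v‖ ^ 2 + ∑ i, ∫ s, ‖ξ i s‖ ^ 2 ∂ν) := by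
  set ρ := Measure.pi fun _ : Fin n => ν
  have hI : ∀ i, Integrable (fun s : Fin n → S => ξ i (s i)) ρ := fun i =>
    integrable_comp_eval (hint i)
  have hI2 : ∀ i, Integrable (fun s : Fin n → S => ‖ξ i (s i)‖ ^ 2) ρ := fun i =>
    integrable_comp_eval (X := fun _ : Fin n => S) (i := i) (f := fun s => ‖ξ i s‖ ^ 2) (hsq i)
  have hm : ∀ i, ∫ s, ξ i (s i) ∂ρ = 0 := fun i => by
    rw [← hmean i]
    exact integral_comp_eval (hint i).aestronglyMeasurable
  have hm2 : ∀ i, ∫ s, ‖ξ i (s i)‖ ^ 2 ∂ρ = ∫ s, ‖ξ i s‖ ^ 2 ∂ν := fun i =>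
    integral_comp_eval (X := fun _ : Fin n => S) (i := i) (f := fun s => ‖ξ i s‖ ^ 2)
      (hsq i).aestronglyMeasurable
  have hIin : ∀ i j, Integrable (fun s : Fin n → S => inner ℝ (ξ i (s i)) (ξ j (s j))) ρ := by
    intro i j
    refine ((hI2 i).add (hI2 j)).mono' ((hI i).aestronglyMeasurable.inner
      (hI j).aestronglyMeasurable) (Filter.Eventually.of_forall fun s => ?_)
    have h1 := norm_inner_le_norm (𝕜 := ℝ) (ξ i (s i)) (ξ j (s j))
    simp only [Pi.add_apply]
    nlinarith [sq_nonneg (‖ξ i (s i)‖ - ‖ξ j (s j)‖), sq_nonneg ‖ξ i (s i)‖,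
      sq_nonneg ‖ξ j (s j)‖]
  -- Distinct coordinates of a product measure are independent, so the centred cross terms vanish
  -- and only the diagonal survives.
  have hzero : ∀ i j, i ≠ j → ∫ s, inner ℝ (ξ i (s i)) (ξ j (s j)) ∂ρ = 0 := by
    intro i j hij
    borelize H
    have hind : IndepFun (fun s : Fin n → S => ξ i (s i)) (fun s => ξ j (s j)) ρ :=
      (iIndepFun_pi fun i => (hint i).aestronglyMeasurable.aemeasurable).indepFun hij
    have h := hind.integral_bilin (hI i) (hI j) (innerSL ℝ)
    rw [hm i, map_zero] at h
    exact h
  have hexp : ∀ s : Fin n → S, ‖v + ∑ i, ξ i (s i)‖ ^ 2 =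
      (‖v‖ ^ 2 + ∑ i, 2 * inner ℝ v (ξ i (s i))) +
        ∑ i, ∑ j, inner ℝ (ξ i (s i)) (ξ j (s j)) := by
    intro s
    rw [norm_add_sq_real, ← real_inner_self_eq_norm_sq (∑ i, ξ i (s i)), inner_sum, sum_inner,
      Finset.mul_sum]
    simp_rw [inner_sum]
  have hA : Integrable (fun s : Fin n → S => ∑ i, 2 * inner ℝ v (ξ i (s i))) ρ :=
    integrable_finsetSum _ fun i _ => ((hI i).const_inner v).const_mul 2
  have hB : Integrable
      (fun s : Fin n → S => ∑ i, ∑ j, inner ℝ (ξ i (s i)) (ξ j (s j))) ρ :=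
    integrable_finsetSum _ fun i _ => integrable_finsetSum _ fun j _ => hIin i j
  have hC : Integrable (fun s : Fin n → S => ‖v‖ ^ 2 + ∑ i, 2 * inner ℝ v (ξ i (s i))) ρ :=
    (integrable_const _).add hA
  have hD : Integrable (fun s : Fin n → S => ‖v + ∑ i, ξ i (s i)‖ ^ 2) ρ :=
    (hC.add hB).congr (Filter.Eventually.of_forall fun s => (hexp s).symm)
  rw [← ofReal_integral_eq_lintegral_ofReal hD (Filter.Eventually.of_forall fun s => by positivity)]
  congr 1
  simp_rw [hexp]
  rw [integral_add hC hB, integral_add (integrable_const _) hA, integral_finsetSum _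
    (fun i _ => ((hI i).const_inner v).const_mul 2), integral_finsetSum _
    (fun i _ => integrable_finsetSum _ fun j _ => hIin i j)]
  have h1 : ∀ i, ∫ s, 2 * inner ℝ v (ξ i (s i)) ∂ρ = 0 := fun i => by
    rw [integral_const_mul, integral_inner (hI i), hm i, inner_zero_right, mul_zero]
  have h2 : ∀ i, ∫ s, ∑ j, inner ℝ (ξ i (s i)) (ξ j (s j)) ∂ρ = ∫ s, ‖ξ i s‖ ^ 2 ∂ν := by
    intro i
    rw [integral_finsetSum _ (fun j _ => hIin i j), Finset.sum_eq_single i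
      (fun j _ hj => hzero i j hj.symm) (by simp), ← hm2 i]
    simp_rw [real_inner_self_eq_norm_sq]
  simp [h1, h2]

end Variance

/-! ### Measurability of tangent vector fields through charts. -/

section Measurability

lemma measurable_of_countable_cover {α β ι : Type*} [Countable ι] [MeasurableSpace α]
    [MeasurableSpace β] {g : α → β} {t : ι → Set α} (ht : ∀ i, MeasurableSet (t i))
    (hcov : ∀ a, ∃ i, a ∈ t i) {h : ι → α → β} (hh : ∀ i, Measurable (h i))
    (heq : ∀ i, EqOn g (h i) (t i)) : Measurable g := by
  intro B hB
  have : g ⁻¹' B = ⋃ i, t i ∩ h i ⁻¹' B := by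
    ext a
    simp only [mem_preimage, mem_iUnion, mem_inter_iff]
    constructor
    · intro ha
      obtain ⟨i, hi⟩ := hcov a
      exact ⟨i, hi, by rwa [← heq i hi]⟩
    · rintro ⟨i, hi, ha⟩
      rwa [heq i hi]
  rw [this]
  exact MeasurableSet.iUnion fun i => (ht i).inter (hh i hB)

variable {d : ℕ} {M : Type*} [TopologicalSpace M] [ChartedSpace (EuclideanSpace ℝ (Fin d)) M]
  [IsManifold (𝓡 d) ∞ M]

local notation "𝔼" => EuclideanSpace ℝ (Fin d)

instance tangentBundleBorelSpace : BorelSpace (TangentBundle (𝓡 d) M) := ⟨rfl⟩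

lemma coord_of_notMem {c x : M} (hx : x ∉ (chartAt 𝔼 c).source) (v : TangentSpace (𝓡 d) x) :
    coord c x v = 0 := by
  have h : x ∉ (trivializationAt 𝔼 (fun y : M => TangentSpace (𝓡 d) y) c).baseSet := hx
  rw [coord, Trivialization.continuousLinearMapAt_apply, Trivialization.linearMapAt_def_of_notMem _ h]
  rfl

/-- Continuous on the open domain of the trivialisation, and the default value 0 elsewhere. -/
lemma measurable_coord (c : M) :
    Measurable (fun q : TangentBundle (𝓡 d) M => coord c q.1 q.2) := by
  classical
  set e := trivializationAt 𝔼 (fun y : M => TangentSpace (𝓡 d) y) c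
  have h1 : ContinuousOn (fun q : TangentBundle (𝓡 d) M => (e q).2) e.source :=
    continuous_snd.comp_continuousOn e.continuousOn
  have h2 := h1.measurable_piecewise (continuousOn_const (c := (0 : 𝔼))) e.open_source.measurableSet
  convert! h2 using 1
  ext1 q
  by_cases hq : q ∈ e.source
  · rw [piecewise_eq_of_mem _ _ _ hq]
    exact Trivialization.continuousLinearMapAt_apply_of_mem (R := ℝ) e (e.mem_source.1 hq) q.2
  · rw [piecewise_eq_of_notMem _ _ _ hq]
    exact coord_of_notMem (fun h => hq (e.mem_source.2 h)) _

/-- The coordinates of the vector field `u` along the map `x` are measurable in every chart. -/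
def MeasurableField {α : Type*} [MeasurableSpace α] (x : α → M)
    (u : (a : α) → TangentSpace (𝓡 d) (x a)) : Prop :=
  ∀ c : M, Measurable fun a => coord c (x a) (u a)

section Field

variable {α : Type*} [MeasurableSpace α] {x : α → M} {u v : (a : α) → TangentSpace (𝓡 d) (x a)}

lemma MeasurableField.of_measurable
    (h : Measurable fun a => (⟨x a, u a⟩ : TangentBundle (𝓡 d) M)) : MeasurableField x u :=
  fun c => (measurable_coord c).comp h

lemma measurable_proj_of_measurable [MeasurableSpace M] [BorelSpace M]
    (h : Measurable fun a => (⟨x a, u a⟩ : TangentBundle (𝓡 d) M)) : Measurable x :=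
  (FiberBundle.continuous_proj 𝔼 (fun y : M => TangentSpace (𝓡 d) y)).measurable.comp h

lemma MeasurableField.add (hu : MeasurableField x u) (hv : MeasurableField x v) :
    MeasurableField x (fun a => u a + v a) := fun c => by
  simp only [coord_add]
  exact (hu c).add (hv c)

lemma MeasurableField.sub (hu : MeasurableField x u) (hv : MeasurableField x v) :
    MeasurableField x (fun a => u a - v a) := fun c => by
  simp only [coord_sub]
  exact (hu c).sub (hv c)

lemma MeasurableField.const_smul (hu : MeasurableField x u) (r : ℝ) :
    MeasurableField x (fun a => r • u a) := fun c => by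
  simp only [coord_smul]
  exact (hu c).const_smul r

lemma MeasurableField.sum {ι : Type*} {s : Finset ι}
    {w : ι → (a : α) → TangentSpace (𝓡 d) (x a)} (hw : ∀ i, MeasurableField x (w i)) :
    MeasurableField x (fun a => ∑ i ∈ s, w i a) := fun c => by
  simp only [coord_sum]
  exact Finset.measurable_fun_sum s fun i _ => hw i c

lemma MeasurableField.ite {p : α → Prop} [DecidablePred p] (hp : MeasurableSet {a | p a})
    (hu : MeasurableField x u) (hv : MeasurableField x v) :
    MeasurableField x (fun a => if p a then u a else v a) := fun c => by
  simp only [apply_ite (coord c _)]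
  exact Measurable.ite hp (hu c) (hv c)

end Field

variable [RiemannianBundle (fun x : M => TangentSpace (𝓡 d) x)]
  [IsContMDiffRiemannianBundle (𝓡 d) ∞ (EuclideanSpace ℝ (Fin d))
      (fun x : M => TangentSpace (𝓡 d) x)]

lemma norm_sq_eq_metricForm {c x : M} (hx : x ∈ (chartAt 𝔼 c).source)
    (v : TangentSpace (𝓡 d) x) :
    ‖v‖ ^ 2 = metricForm c (extChartAt (𝓡 d) c x) (coord c x v) (coord c x v) := by
  rw [← real_inner_self_eq_norm_sq]
  exact inner_eq_chartMetric hx v v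

/-- Second countability leaves countably many charts, in each of which the squared norm is
continuous in the point and the coordinates. -/
lemma MeasurableField.norm_sq [SecondCountableTopology M] [MeasurableSpace M] [BorelSpace M]
    {α : Type*} [MeasurableSpace α] {x : α → M} {u : (a : α) → TangentSpace (𝓡 d) (x a)}
    (hx : Measurable x) (hu : MeasurableField x u) : Measurable fun a => ‖u a‖ ^ 2 := by
  classical
  obtain ⟨s, hs, hcov⟩ := TopologicalSpace.countable_cover_nhds (chart_source_mem_nhds 𝔼 (M := M))
  have : Countable s := hs.to_subtype
  have hc : ∀ c : M, Measurable (((chartAt 𝔼 c).source ×ˢ univ).piecewise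
      (fun q : M × 𝔼 => metricForm c (extChartAt (𝓡 d) c q.1) q.2 q.2) (fun _ => 0)) := by
    intro c
    refine ContinuousOn.measurable_piecewise ?_ continuousOn_const
      ((chartAt 𝔼 c).open_source.prod isOpen_univ).measurableSet
    have h1 : ContinuousOn (fun q : M × 𝔼 => metricForm c (extChartAt (𝓡 d) c q.1))
        ((chartAt 𝔼 c).source ×ˢ univ) := by
      refine (contDiffOn_metricForm c).continuousOn.comp (f := fun q : M × 𝔼 =>
        extChartAt (𝓡 d) c q.1) (t := (extChartAt (𝓡 d) c).target) ?_
        (fun q hq => extChart_mem_target hq.1)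
      refine (continuousOn_extChartAt c).comp continuousOn_fst fun q hq => ?_
      rw [extChartAt_source]
      exact hq.1
    exact (h1.clm_apply continuousOn_snd).clm_apply continuousOn_snd
  refine measurable_of_countable_cover (ι := s) (t := fun c => x ⁻¹' (chartAt 𝔼 (c : M)).source)
    (fun c => hx (chartAt 𝔼 (c : M)).open_source.measurableSet) (fun a => ?_)
    (fun c => (hc c).comp (hx.prodMk (hu c))) (fun c a ha => ?_)
  · have : x a ∈ ⋃ c ∈ s, (chartAt 𝔼 c).source := by rw [hcov]; trivial
    obtain ⟨c, hcs, hca⟩ := mem_iUnion₂.1 this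
    exact ⟨⟨c, hcs⟩, hca⟩
  · rw [Function.comp_apply, piecewise_eq_of_mem _ _ _ (mk_mem_prod (mem_preimage.1 ha) (mem_univ _))]
    exact norm_sq_eq_metricForm ha _

lemma metricInv_metricForm {c : M} {z : 𝔼} (hz : z ∈ (extChartAt (𝓡 d) c).target) (a : 𝔼) :
    metricInv c z (metricForm c z a) = a := by
  obtain ⟨e, he⟩ := exists_metricEquiv hz
  rw [metricInv, ← he, ContinuousLinearMap.inverse_equiv]
  exact e.symm_apply_apply a

lemma coord_grad {f : M → ℝ} {c x : M} (hf : MDifferentiableAt (𝓡 d) 𝓘(ℝ, ℝ) f x)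
    (hx : x ∈ (chartAt 𝔼 c).source) :
    coord c x (grad f x) = metricInv c (extChartAt (𝓡 d) c x)
      (fderiv ℝ (fun z => f ((extChartAt (𝓡 d) c).symm z)) (extChartAt (𝓡 d) c x)) := by
  have hz := extChart_mem_target hx
  rw [← metricInv_metricForm hz (coord c x (grad f x))]
  congr 1
  ext w
  have h1 : MDifferentiableAt 𝓘(ℝ, 𝔼) (𝓡 d) (extChartAt (𝓡 d) c).symm (extChartAt (𝓡 d) c x) :=
    ((contMDiffOn_extChartAt_symm (n := ∞) c).contMDiffAt
      ((isOpen_extChartAt_target c).mem_nhds hz)).mdifferentiableAt (by simp)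
  have hf' : MDifferentiableAt (𝓡 d) 𝓘(ℝ, ℝ) f
      ((extChartAt (𝓡 d) c).symm (extChartAt (𝓡 d) c x)) := by rwa [extChart_left_inv hx]
  have h2 : DifferentiableAt ℝ (fun z => f ((extChartAt (𝓡 d) c).symm z))
      (extChartAt (𝓡 d) c x) :=
    (hf'.comp (extChartAt (𝓡 d) c x) h1).differentiableAt
  have h3 : MDifferentiableAt (𝓡 d) 𝓘(ℝ, 𝔼) (extChartAt (𝓡 d) c) x :=
    mdifferentiableAt_extChartAt hx
  have h4 := h2.hasFDerivAt.hasMFDerivAt.comp x h3.hasMFDerivAt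
  have h5 : ((fun z => f ((extChartAt (𝓡 d) c).symm z)) ∘ extChartAt (𝓡 d) c)
      =ᶠ[nhds x] f := by
    filter_upwards [(chartAt 𝔼 c).open_source.mem_nhds hx] with y hy
    simp only [Function.comp, extChart_left_inv hy]
  have h6 : metricForm c (extChartAt (𝓡 d) c x) (coord c x (grad f x)) w =
      inner ℝ (grad f x) (uncoord c x w) := by
    rw [inner_eq_chartMetric hx, coord_uncoord hx]
    rfl
  have h7 : mfderiv (𝓡 d) 𝓘(ℝ, 𝔼) (extChartAt (𝓡 d) c) x (uncoord c x w) = w := by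
    rw [← coord_eq_mfderiv hx, coord_uncoord hx]
  rw [h6, inner_grad, ← h5.mfderiv_eq, h4.mfderiv]
  exact congrArg _ h7

/-- The Fréchet derivative of any real function is measurable, so differentiability suffices; the
inverse metric, which raises the index, is continuous. -/
lemma measurableField_grad [SecondCountableTopology M] [MeasurableSpace M] [BorelSpace M]
    {f : M → ℝ} (hf : MDifferentiable (𝓡 d) 𝓘(ℝ, ℝ) f) {α : Type*} [MeasurableSpace α] {x : α → M}
    (hx : Measurable x) : MeasurableField (d := d) x (fun a => grad f (x a)) := by
  classical
  intro c
  suffices h : Measurable fun y : M => coord (d := d) c y (grad f y) from h.comp hx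
  set s := (chartAt 𝔼 c).source
  have hs : IsOpen s := (chartAt 𝔼 c).open_source
  have h1 : Measurable (s.piecewise (extChartAt (𝓡 d) c) (fun _ => 0)) := by
    refine ContinuousOn.measurable_piecewise ?_ continuousOn_const hs.measurableSet
    have := continuousOn_extChartAt (I := 𝓡 d) c
    rwa [extChartAt_source] at this
  have h2 : Measurable fun y : M => fderiv ℝ (fun z => f ((extChartAt (𝓡 d) c).symm z))
      (s.piecewise (extChartAt (𝓡 d) c) (fun _ => 0) y) := (measurable_fderiv ℝ _).comp h1
  have h3 : Measurable ((s ×ˢ univ).piecewise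
      (fun q : M × (𝔼 →L[ℝ] ℝ) => metricInv c (extChartAt (𝓡 d) c q.1) q.2) (fun _ => 0)) := by
    refine ContinuousOn.measurable_piecewise ?_ continuousOn_const
      (hs.prod isOpen_univ).measurableSet
    intro q hq
    have hz := extChart_mem_target (d := d) hq.1
    have h4 : ContinuousAt (extChartAt (𝓡 d) c) q.1 :=
      continuousAt_extChartAt' (by rw [extChartAt_source]; exact hq.1)
    have h5 : ContinuousAt (fun q : M × (𝔼 →L[ℝ] ℝ) => extChartAt (𝓡 d) c q.1) q :=
      ContinuousAt.comp (f := Prod.fst) h4 continuousAt_fst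
    have h6 : ContinuousAt (fun q : M × (𝔼 →L[ℝ] ℝ) => metricInv c (extChartAt (𝓡 d) c q.1)) q :=
      ContinuousAt.comp (f := fun q : M × (𝔼 →L[ℝ] ℝ) => extChartAt (𝓡 d) c q.1)
        (continuousAt_metricInv hz) h5
    exact (h6.clm_apply continuousAt_snd).continuousWithinAt
  convert! h3.comp (measurable_id.prodMk h2) using 1
  ext1 y
  by_cases hy : y ∈ s
  · rw [Function.comp_apply, id, piecewise_eq_of_mem _ _ _ (mk_mem_prod hy (mem_univ _)), coord_grad (hf y) hy]
    simp [piecewise_eq_of_mem _ _ _ hy]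
  · rw [Function.comp_apply, piecewise_eq_of_notMem _ _ _ (fun h => hy h.1), coord_of_notMem hy]

end Measurability

/-! ### Expected decrease of the Lyapunov function in one iteration. -/

section OneStep

variable {d n : ℕ} {M : Type*} [TopologicalSpace M] [ChartedSpace (EuclideanSpace ℝ (Fin d)) M]
  [IsManifold (𝓡 d) ∞ M]
  [RiemannianBundle (fun x : M => TangentSpace (𝓡 d) x)]
  [IsContMDiffRiemannianBundle (𝓡 d) ∞ (EuclideanSpace ℝ (Fin d))
      (fun x : M => TangentSpace (𝓡 d) x)]
  {S : Type*} [MeasurableSpace S]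

/-- Parallel transport along one iteration as a linear isometry. -/
def State.moveₗᵢ (hM : GeodesicallyComplete d M) (η : ℝ) (σ : State d n M) :
    TangentSpace (𝓡 d) σ.point →ₗᵢ[ℝ] TangentSpace (𝓡 d) (σ.next η) :=
  expTransportₗᵢ hM σ.point (-(η • σ.mean))

/-- The error `gᵏ - ∇f(xᵏ)` of the gradient estimator. -/
def State.err (f : Fin n → M → ℝ) (σ : State d n M) : TangentSpace (𝓡 d) σ.point :=
  σ.mean - (n : ℝ)⁻¹ • ∑ i, grad (f i) σ.point

/-- The Lyapunov function `f(xᵏ) - f* + a ‖gᵏ - ∇f(xᵏ)‖²`. -/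
def State.lyapunov (f : Fin n → M → ℝ) (fstar a : ℝ) (σ : State d n M) : ℝ :=
  average f σ.point - fstar + a * ‖σ.err f‖ ^ 2

/-- The error after one iteration, as a tangent vector at the next point. -/
def State.errNext (f : Fin n → M → ℝ)
    (Q : Fin n → (x : M) → S → TangentSpace (𝓡 d) x → TangentSpace (𝓡 d) x) (η : ℝ)
    (coin : Bool) (s : Fin n → S) (σ : State d n M) : TangentSpace (𝓡 d) (σ.next η) :=
  (n : ℝ)⁻¹ • ∑ i, (if coin then grad (f i) (σ.next η)
    else σ.move η (σ.vec i) + Q i (σ.next η) (s i) (σ.diff f η i)) -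
      (n : ℝ)⁻¹ • ∑ i, grad (f i) (σ.next η)

lemma State.lyapunov_step (f : Fin n → M → ℝ)
    (Q : Fin n → (x : M) → S → TangentSpace (𝓡 d) x → TangentSpace (𝓡 d) x) (η fstar a : ℝ)
    (coin : Bool) (s : Fin n → S) (σ : State d n M) :
    (σ.step f Q η coin s).lyapunov f fstar a =
      average f (σ.next η) - fstar + a * ‖σ.errNext f Q η coin s‖ ^ 2 := rfl

lemma State.errNext_true (f : Fin n → M → ℝ)
    (Q : Fin n → (x : M) → S → TangentSpace (𝓡 d) x → TangentSpace (𝓡 d) x) (η : ℝ)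
    (s : Fin n → S) (σ : State d n M) : σ.errNext f Q η true s = 0 := by
  simp [State.errNext]

/-- Inserting ∇fᵢ(xᵏ⁺¹) = Γ∇fᵢ(xᵏ) + (gradient difference) leaves the transported error and the
deviation of each compressor from its input, which has mean zero. -/
lemma State.errNext_false (hM : GeodesicallyComplete d M) (f : Fin n → M → ℝ)
    (Q : Fin n → (x : M) → S → TangentSpace (𝓡 d) x → TangentSpace (𝓡 d) x) (η : ℝ)
    (s : Fin n → S) (σ : State d n M) :
    σ.errNext f Q η false s = σ.moveₗᵢ hM η (σ.err f) +
      ∑ i, (n : ℝ)⁻¹ • (Q i (σ.next η) (s i) (σ.diff f η i) - σ.diff f η i) := by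
  have h1 : ∀ i, σ.diff f η i = grad (f i) (σ.next η) -
      σ.moveₗᵢ hM η (grad (f i) σ.point) := fun i => rfl
  have h2 : σ.errNext f Q η false s = (n : ℝ)⁻¹ • ∑ i,
      (σ.moveₗᵢ hM η (σ.vec i) +
        Q i (σ.next η) (s i) (σ.diff f η i)) - (n : ℝ)⁻¹ • ∑ i, grad (f i) (σ.next η) := rfl
  rw [h2, State.err, State.mean, map_sub, map_smul, map_smul, map_sum, map_sum, ← Finset.smul_sum,
    ← smul_sub, ← smul_sub, ← smul_add, ← Finset.sum_sub_distrib, ← Finset.sum_sub_distrib,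
    ← Finset.sum_add_distrib]
  congr 1
  refine Finset.sum_congr rfl fun i _ => ?_
  generalize Q i (σ.next η) (s i) (σ.diff f η i) = q
  rw [h1 i]
  abel

lemma average_expMap_le (hM : GeodesicallyComplete d M) (hn : 0 < n) {f : Fin n → M → ℝ} {L : ℝ}
    (hf : ∀ i, GSmooth (d := d) L (f i)) (x : M) (v : TangentSpace (𝓡 d) x) :
    average f (expMap x v) ≤ average f x + inner ℝ (grad (average f) x) v + L / 2 * ‖v‖ ^ 2 := by
  rw [grad_average fun i => (hf i).1 x, real_inner_smul_left, sum_inner, average, average]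
  have h1 : ∑ i, f i (expMap x v) ≤
      ∑ i, (f i x + inner ℝ (grad (f i) x) v + L / 2 * ‖v‖ ^ 2) :=
    Finset.sum_le_sum fun i _ => (hf i).expMap_le hM x v
  have hn' : (0 : ℝ) < n := by exact_mod_cast hn
  have h2 := mul_le_mul_of_nonneg_left h1 (inv_nonneg.2 hn'.le)
  rw [Finset.sum_add_distrib, Finset.sum_add_distrib, Finset.sum_const, Finset.card_univ,
    Fintype.card_fin, nsmul_eq_mul] at h2
  refine h2.trans (le_of_eq ?_)
  field_simp

lemma State.err_eq {f : Fin n → M → ℝ} {L : ℝ} (hf : ∀ i, GSmooth (d := d) L (f i))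
    (σ : State d n M) : σ.err f = σ.mean - grad (average f) σ.point := by
  rw [grad_average fun i => (hf i).1 _]
  rfl

/-- The real inequality behind the decrease of the Lyapunov function. -/
lemma lyapunov_decrease {F F' E G a L μ γ p ϖ N : ℝ} (hE : 0 ≤ E) (hG : 0 ≤ G) (hN : 0 < N)
    (hL : 0 < L) (hμ : 0 < μ) (hp : 0 < p) (hp1 : p ≤ 1) (hϖ : 0 ≤ ϖ) (hγ : 0 < γ)
    (hγle : γ ≤ min (1 / (L * (1 + √(2 * (1 - p) * ϖ / (p * N))))) (p / (2 * μ)))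
    (hF' : F' ≤ F + γ / 2 * (E - G - a) + L / 2 * (γ ^ 2 * G)) (ha : 2 * μ * F ≤ a) :
    F' + (1 - p) * (γ / p) * (E + ϖ * L ^ 2 * γ ^ 2 / N * G) ≤
      (1 - γ * μ) * (F + γ / p * E) := by
  set s := √(2 * (1 - p) * ϖ / (p * N)) with hs
  have hs0 : 0 ≤ s := Real.sqrt_nonneg _
  have hs2 : s ^ 2 = 2 * (1 - p) * ϖ / (p * N) :=
    Real.sq_sqrt (by have : 0 ≤ 1 - p := by linarith
                     positivity)
  have hstep : L * γ * (1 + s) ≤ 1 := by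
    have h := hγle.trans (min_le_left _ _)
    rw [le_div_iff₀ (by positivity)] at h
    linarith
  have hγμ : γ * (2 * μ) ≤ p := by
    have h := hγle.trans (min_le_right _ _)
    rwa [le_div_iff₀ (by positivity)] at h
  -- From sLγ ≤ 1 - Lγ ∈ [0, 1], squaring gives (1 - Lγ)² ≤ 1 - Lγ.
  have hquad : s ^ 2 * (L * γ) ^ 2 ≤ 1 - L * γ := by
    have h1 : 0 < L * γ := by positivity
    have h2 : s * (L * γ) ≤ 1 - L * γ := by linarith
    have h3 : 0 ≤ s * (L * γ) := by positivity
    nlinarith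
  -- The compression variance is paid for by the term -(γ/2)(1 - Lγ)‖g‖² left over from the descent
  -- inequality.
  have hG' : (1 - p) * (γ / p) * (ϖ * L ^ 2 * γ ^ 2 / N * G) ≤ γ / 2 * (1 - L * γ) * G := by
    have h1 : (1 - p) * (γ / p) * (ϖ * L ^ 2 * γ ^ 2 / N * G) =
        γ / 2 * (s ^ 2 * (L * γ) ^ 2) * G := by
      rw [hs2]
      field_simp
    rw [h1]
    gcongr
  -- After division by γ/p this says p/2 + 1 - p ≤ 1 - γμ, that is γ ≤ p/(2μ); it explains the
  -- weight γ/p.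
  have hE' : γ / 2 * E + (1 - p) * (γ / p) * E ≤ (1 - γ * μ) * (γ / p * E) := by
    have h1 : (1 - γ * μ) * (γ / p * E) - (γ / 2 * E + (1 - p) * (γ / p) * E) =
        γ / p * E * ((p - γ * (2 * μ)) / 2) := by
      field_simp
      ring
    have h2 : 0 ≤ γ / p * E * ((p - γ * (2 * μ)) / 2) :=
      mul_nonneg (by positivity) (by linarith)
    linarith
  have ha' : γ / 2 * (2 * μ * F) ≤ γ / 2 * a := by gcongr
  nlinarith

/-- The Lyapunov function decreases in expectation. -/
lemma State.lintegral_lyapunov_step_le (hM : GeodesicallyComplete d M) (hn : 0 < n)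
    {f : Fin n → M → ℝ} {L μ fstar : ℝ} (hL : 0 < L) (hμ : 0 < μ)
    (hsmooth : ∀ i, GSmooth (d := d) L (f i)) (hPL : PLCondition d μ fstar (average f))
    {ν : Measure S} [IsProbabilityMeasure ν] {ϖ : ℝ} (hϖ : 0 ≤ ϖ)
    {Q : Fin n → (x : M) → S → TangentSpace (𝓡 d) x → TangentSpace (𝓡 d) x}
    (hQ : ∀ i, IsUnbiasedCompressor ν ϖ (Q i)) {p γ : ℝ} (hp : 0 < p) (hp1 : p ≤ 1) (hγ : 0 < γ)
    (hγle : γ ≤ min (1 / (L * (1 + √(2 * (1 - p) * ϖ / (p * n))))) (p / (2 * μ)))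
    (σ : State d n M)
    (hmeas : Measurable fun z : Bool × (Fin n → S) =>
      (σ.step f Q γ z.1 z.2).lyapunov f fstar (γ / p)) :
    ∫⁻ z, ENNReal.ofReal ((σ.step f Q γ z.1 z.2).lyapunov f fstar (γ / p)) ∂(stepLaw n p ν) ≤
      ENNReal.ofReal (1 - γ * μ) * ENNReal.ofReal (σ.lyapunov f fstar (γ / p)) := by
  have hn' : (0 : ℝ) < n := by exact_mod_cast hn
  have hp' : 0 ≤ 1 - p := by linarith
  set F' := average f (σ.next γ) - fstar with hF'
  have hF'0 : 0 ≤ F' := sub_nonneg.2 (hPL.1 _)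
  set ξ : Fin n → S → TangentSpace (𝓡 d) (σ.next γ) := fun i s =>
    (n : ℝ)⁻¹ • (Q i (σ.next γ) s (σ.diff f γ i) - σ.diff f γ i) with hξ
  have hξint : ∀ i, Integrable (ξ i) ν := fun i =>
    (((hQ i).integrable (σ.next γ) (σ.diff f γ i)).sub
      (integrable_const (σ.diff f γ i))).smul ((n : ℝ)⁻¹)
  have hξsq : ∀ i s, ‖ξ i s‖ ^ 2 =
      ((n : ℝ)⁻¹) ^ 2 * ‖Q i (σ.next γ) s (σ.diff f γ i) - σ.diff f γ i‖ ^ 2 := fun i s => by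
    rw [hξ, norm_smul, mul_pow, norm_inv, Real.norm_natCast]
  have hξint2 : ∀ i, Integrable (fun s => ‖ξ i s‖ ^ 2) ν := fun i => by
    simp_rw [hξsq]
    exact ((hQ i).integrable_sq _ _).const_mul _
  have hcomplete : CompleteSpace (TangentSpace (𝓡 d) (σ.next γ)) :=
    have : FiniteDimensional ℝ (TangentSpace (𝓡 d) (σ.next γ)) :=
      inferInstanceAs (FiniteDimensional ℝ (EuclideanSpace ℝ (Fin d)))
    FiniteDimensional.complete ℝ _
  have hξmean : ∀ i, ∫ s, ξ i s ∂ν = 0 := fun i => by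
    rw [hξ]
    simp only
    rw [integral_smul, integral_sub ((hQ i).integrable _ _) (integrable_const _),
      (hQ i).unbiased]
    simp
  have hdiff : ∀ i, ‖σ.diff f γ i‖ ^ 2 ≤ L ^ 2 * γ ^ 2 * ‖σ.mean‖ ^ 2 := fun i => by
    have h1 : ‖σ.diff f γ i‖ ≤ L * ‖-(γ • σ.mean)‖ :=
      (hsmooth i).norm_grad_expMap_sub_le hM σ.point (-(γ • σ.mean))
    rw [norm_neg, norm_smul, Real.norm_of_nonneg hγ.le] at h1
    calc ‖σ.diff f γ i‖ ^ 2 ≤ (L * (γ * ‖σ.mean‖)) ^ 2 := by gcongr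
      _ = L ^ 2 * γ ^ 2 * ‖σ.mean‖ ^ 2 := by ring
  -- Each noise carries the factor n⁻² and there are n of them: averaging independent compressors
  -- divides the variance by n.
  have hvar : ∑ i, ∫ s, ‖ξ i s‖ ^ 2 ∂ν ≤ ϖ * L ^ 2 * γ ^ 2 / n * ‖σ.mean‖ ^ 2 := by
    have h1 : ∀ i, ∫ s, ‖ξ i s‖ ^ 2 ∂ν ≤
        ((n : ℝ)⁻¹) ^ 2 * (ϖ * (L ^ 2 * γ ^ 2 * ‖σ.mean‖ ^ 2)) := fun i => by
      simp_rw [hξsq]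
      rw [integral_const_mul]
      gcongr
      exact ((hQ i).variance_le _ _).trans (mul_le_mul_of_nonneg_left (hdiff i) hϖ)
    refine (Finset.sum_le_sum fun i _ => h1 i).trans (le_of_eq ?_)
    rw [Finset.sum_const, Finset.card_univ, Fintype.card_fin, nsmul_eq_mul]
    field_simp
  set W := ∑ i, ∫ s, ‖ξ i s‖ ^ 2 ∂ν with hW
  have hW0 : 0 ≤ W := Finset.sum_nonneg fun i _ => integral_nonneg fun s => by positivity
  have hfalse : ∫⁻ s, ENNReal.ofReal ((σ.step f Q γ false s).lyapunov f fstar (γ / p))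
      ∂(Measure.pi fun _ : Fin n => ν) = ENNReal.ofReal (F' + γ / p * (‖σ.err f‖ ^ 2 + W)) := by
    have h1 : ∀ s : Fin n → S, ENNReal.ofReal ((σ.step f Q γ false s).lyapunov f fstar (γ / p)) =
        ENNReal.ofReal F' + ENNReal.ofReal (γ / p) *
          ENNReal.ofReal (‖σ.moveₗᵢ hM γ (σ.err f) + ∑ i, ξ i (s i)‖ ^ 2) := fun s => by
      rw [State.lyapunov_step, State.errNext_false hM, ← hF',
        ENNReal.ofReal_add hF'0 (by positivity), ENNReal.ofReal_mul (by positivity)]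
    simp_rw [h1]
    rw [lintegral_add_left measurable_const, lintegral_const_mul' _ _ ENNReal.ofReal_ne_top,
      lintegral_norm_sq_const_add_sum ν hξint hξint2 hξmean, lintegral_const, measure_univ,
      mul_one, LinearIsometry.norm_map, ← ENNReal.ofReal_mul (by positivity),
      ← ENNReal.ofReal_add hF'0 (by positivity)]
  have htrue : ∫⁻ s, ENNReal.ofReal ((σ.step f Q γ true s).lyapunov f fstar (γ / p))
      ∂(Measure.pi fun _ : Fin n => ν) = ENNReal.ofReal F' := by
    simp_rw [State.lyapunov_step, State.errNext_true]
    simp [← hF']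
  have hlaw : ∫⁻ z, ENNReal.ofReal ((σ.step f Q γ z.1 z.2).lyapunov f fstar (γ / p))
      ∂(stepLaw n p ν) = ENNReal.ofReal (F' + (1 - p) * (γ / p) * (‖σ.err f‖ ^ 2 + W)) := by
    rw [stepLaw, lintegral_prod _ hmeas.ennreal_ofReal.aemeasurable, lintegral_add_measure,
      lintegral_smul_measure, lintegral_smul_measure, lintegral_dirac, lintegral_dirac, htrue,
      hfalse, smul_eq_mul, smul_eq_mul, ← ENNReal.ofReal_mul hp.le, ← ENNReal.ofReal_mul hp',
      ← ENNReal.ofReal_add (by positivity) (by positivity)]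
    congr 1
    ring
  have hγμ : γ * μ ≤ 1 := by
    have h := hγle.trans (min_le_right _ _)
    rw [le_div_iff₀ (by positivity)] at h
    linarith
  rw [hlaw, ← ENNReal.ofReal_mul (by linarith)]
  refine ENNReal.ofReal_le_ofReal ?_
  have hdesc := average_expMap_le hM hn hsmooth σ.point (-(γ • σ.mean))
  have hpol : inner ℝ (grad (average f) σ.point) (-(γ • σ.mean)) =
      γ / 2 * (‖σ.err f‖ ^ 2 - ‖σ.mean‖ ^ 2 - ‖grad (d := d) (average f) σ.point‖ ^ 2) := by
    rw [State.err_eq hsmooth, norm_sub_sq_real, inner_neg_right, real_inner_smul_right,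
      real_inner_comm]
    ring
  rw [hpol, norm_neg, norm_smul, Real.norm_of_nonneg hγ.le, mul_pow] at hdesc
  have hkey := lyapunov_decrease (F := average f σ.point - fstar) (F' := F')
    (sq_nonneg ‖σ.err f‖) (sq_nonneg ‖σ.mean‖) hn' hL hμ hp hp1 hϖ hγ hγle
    (by rw [hF']
        have : average f (σ.next γ) = average f (expMap σ.point (-(γ • σ.mean))) := rfl
        linarith) (hPL.2 σ.point)
  refine le_trans ?_ hkey
  gcongr

end OneStep

/-! ### Independence of the past, joint measurability, minimizers. -/

section Convergence

/-- Integration against the joint law of two independent random variables. -/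
lemma lintegral_comp_prodMk_indepFun {Ω Ω' β : Type*} [MeasurableSpace Ω] [MeasurableSpace Ω']
    [MeasurableSpace β] {P : Measure Ω} [IsProbabilityMeasure P] {φ : Ω → Ω'} {Z : Ω → β}
    (hφ : Measurable φ) (hZ : Measurable Z) (hind : IndepFun φ Z P) {H : Ω' × β → ENNReal}
    (hH : Measurable H) :
    ∫⁻ a, H (φ a, Z a) ∂P = ∫⁻ a, ∫⁻ z, H (φ a, z) ∂(P.map Z) ∂P := by
  have := Measure.isProbabilityMeasure_map (μ := P) hZ.aemeasurable
  have := Measure.isProbabilityMeasure_map (μ := P) hφ.aemeasurable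
  rw [← lintegral_map hH (hφ.prodMk hZ),
    (indepFun_iff_map_prod_eq_prod_map_map hφ.aemeasurable hZ.aemeasurable).1 hind,
    lintegral_prod _ hH.aemeasurable, lintegral_map hH.lintegral_prod_right' hφ]

/-- Integration against the joint law of the past and an independent random variable. -/
lemma lintegral_comp_indep {Ω β : Type*} {m mΩ : MeasurableSpace Ω} [MeasurableSpace β]
    {P : Measure[mΩ] Ω} [IsProbabilityMeasure P] (hm : m ≤ mΩ) {Z : Ω → β}
    (hZ : Measurable[mΩ] Z)
    (hind : Indep (MeasurableSpace.comap Z inferInstance) m P) {H : Ω × β → ENNReal}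
    (hH : Measurable[m.prod inferInstance] H) :
    ∫⁻ a, H (a, Z a) ∂P = ∫⁻ a, ∫⁻ z, H (a, z) ∂(P.map Z) ∂P := by
  -- The past becomes a random variable: the identity map into Ω equipped with the smaller
  -- σ-algebra.
  have hI : @IndepFun Ω Ω β mΩ m _ id Z P := by
    refine (@IndepFun_iff_Indep Ω Ω β mΩ m _ id Z P).2 ?_
    rw [MeasurableSpace.comap_id]
    exact hind.symm
  exact @lintegral_comp_prodMk_indepFun Ω Ω β mΩ m _ P _ id Z (measurable_id'' hm) hZ hI H hH

variable {d n : ℕ} {M : Type*} [TopologicalSpace M] [SecondCountableTopology M]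
  [ChartedSpace (EuclideanSpace ℝ (Fin d)) M]
  [IsManifold (𝓡 d) ∞ M]
  [RiemannianBundle (fun x : M => TangentSpace (𝓡 d) x)]
  [IsContMDiffRiemannianBundle (𝓡 d) ∞ (EuclideanSpace ℝ (Fin d))
      (fun x : M => TangentSpace (𝓡 d) x)]
  {S : Type*} [MeasurableSpace S]

lemma continuous_average {L : ℝ} {f : Fin n → M → ℝ} (hf : ∀ i, GSmooth (d := d) L (f i)) :
    Continuous (average f) :=
  continuous_const.mul (continuous_finsetSum _ fun i _ => (hf i).1.continuous)

/-- The Lyapunov function after one iteration is jointly measurable in the past and in the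
randomness of the iteration. -/
lemma measurable_lyapunov_step (hn : 0 < n) {L : ℝ} {f : Fin n → M → ℝ}
    (hf : ∀ i, GSmooth (d := d) L (f i)) {ν : Measure S} {ϖ : ℝ}
    {Q : Fin n → (x : M) → S → TangentSpace (𝓡 d) x → TangentSpace (𝓡 d) x}
    (hQ : ∀ i, IsUnbiasedCompressor ν ϖ (Q i)) {Ω : Type*} [MeasurableSpace Ω] {η fstar b : ℝ}
    {σ : Ω → State d n M}
    (hmove : ∀ i, Measurable
      fun a => (⟨(σ a).next η, (σ a).move η ((σ a).vec i)⟩ : TangentBundle (𝓡 d) M))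
    (hdiff : ∀ i, Measurable
      fun a => (⟨(σ a).next η, (σ a).diff f η i⟩ : TangentBundle (𝓡 d) M)) :
    Measurable fun q : Ω × (Bool × (Fin n → S)) =>
      ((σ q.1).step f Q η q.2.1 q.2.2).lyapunov f fstar b := by
  borelize M
  have hx : Measurable fun q : Ω × (Bool × (Fin n → S)) => (σ q.1).next η :=
    (measurable_proj_of_measurable (hmove ⟨0, hn⟩)).comp measurable_fst
  have hgrad : ∀ i, MeasurableField (d := d)
      (fun q : Ω × (Bool × (Fin n → S)) => (σ q.1).next η)
      (fun q => grad (f i) ((σ q.1).next η)) := fun i => measurableField_grad (hf i).1 hx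
  have hmove' : ∀ i, MeasurableField (d := d)
      (fun q : Ω × (Bool × (Fin n → S)) => (σ q.1).next η)
      (fun q => (σ q.1).move η ((σ q.1).vec i)) := fun i =>
    MeasurableField.of_measurable ((hmove i).comp measurable_fst)
  have hq : ∀ i, MeasurableField (d := d)
      (fun q : Ω × (Bool × (Fin n → S)) => (σ q.1).next η)
      (fun q => Q i ((σ q.1).next η) (q.2.2 i) ((σ q.1).diff f η i)) := by
    intro i
    have h : Measurable fun q : Ω × (Bool × (Fin n → S)) =>
        (q.2.2 i, (⟨(σ q.1).next η, (σ q.1).diff f η i⟩ : TangentBundle (𝓡 d) M)) :=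
      ((measurable_pi_apply i).comp (measurable_snd.comp measurable_snd)).prodMk
        ((hdiff i).comp measurable_fst)
    exact MeasurableField.of_measurable ((hQ i).measurable.comp h)
  have hcoin : MeasurableSet {q : Ω × (Bool × (Fin n → S)) | q.2.1 = true} :=
    (measurable_fst.comp measurable_snd) (measurableSet_singleton true)
  have herr := (MeasurableField.sum (s := Finset.univ) fun i =>
    (hgrad i).ite hcoin ((hmove' i).add (hq i))).const_smul ((n : ℝ)⁻¹) |>.sub
    ((MeasurableField.sum (s := Finset.univ) hgrad).const_smul ((n : ℝ)⁻¹))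
  have hnorm := MeasurableField.norm_sq hx herr
  simp_rw [State.lyapunov_step]
  exact (((continuous_average hf).measurable.comp hx).sub_const fstar).add (hnorm.const_mul b)

lemma measurable_lyapunov_step_right (hn : 0 < n) {L : ℝ} {f : Fin n → M → ℝ}
    (hf : ∀ i, GSmooth (d := d) L (f i)) {ν : Measure S} {ϖ : ℝ}
    {Q : Fin n → (x : M) → S → TangentSpace (𝓡 d) x → TangentSpace (𝓡 d) x}
    (hQ : ∀ i, IsUnbiasedCompressor ν ϖ (Q i)) (η fstar b : ℝ) (σ : State d n M) :
    Measurable fun z : Bool × (Fin n → S) => (σ.step f Q η z.1 z.2).lyapunov f fstar b := by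
  -- A deterministic state is a random state over a one-point space.
  have h : Measurable fun q : Unit × (Bool × (Fin n → S)) =>
      (σ.step f Q η q.2.1 q.2.2).lyapunov f fstar b :=
    measurable_lyapunov_step hn hf hQ (σ := fun _ : Unit => σ) (fun _ => measurable_const)
      (fun _ => measurable_const)
  have key : ∀ F : Bool × (Fin n → S) → ℝ,
      Measurable (fun q : Unit × (Bool × (Fin n → S)) => F q.2) → Measurable F :=
    fun F hF => hF.comp (measurable_prodMk_left (x := ()))
  exact key _ h

lemma lyapunov_run_zero (f : Fin n → M → ℝ)
    (Q : Fin n → (x : M) → S → TangentSpace (𝓡 d) x → TangentSpace (𝓡 d) x) (η fstar b : ℝ) (x₀ : M)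
    (z : ℕ → Bool × (Fin n → S)) :
    (run f Q η x₀ z 0).lyapunov f fstar b = average f x₀ - fstar := by
  have he : (run f Q η x₀ z 0).err f = 0 := by
    rw [run, State.err, State.mean, sub_self]
  rw [State.lyapunov, he, norm_zero, run]
  simp

/-- A gradient step with stepsize 1/L lowers f by at least ‖∇f(x)‖²/(2L), so the gradient vanishes
at a minimizer and the Polyak–Łojasiewicz inequality forces the value f*. -/
lemma PLCondition.eq_of_minimizer (hM : GeodesicallyComplete d M) (hn : 0 < n) {f : Fin n → M → ℝ}
    {L μ fstar : ℝ} (hL : 0 < L) (hμ : 0 < μ) (hf : ∀ i, GSmooth (d := d) L (f i))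
    (hPL : PLCondition d μ fstar (average f)) {x : M} (hx : ∀ y, average f x ≤ average f y) :
    average f x = fstar := by
  set g := grad (d := d) (average f) x with hg
  have h1 := average_expMap_le hM hn hf x (-(L⁻¹ • g))
  have h2 := hx (expMap x (-(L⁻¹ • g)))
  rw [inner_neg_right, real_inner_smul_right, ← hg, real_inner_self_eq_norm_sq, norm_neg,
    norm_smul, mul_pow, Real.norm_of_nonneg (inv_nonneg.2 hL.le)] at h1
  have h3 : L / 2 * (L⁻¹ ^ 2 * ‖g‖ ^ 2) = L⁻¹ * ‖g‖ ^ 2 / 2 := by field_simp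
  have h4 : L⁻¹ * ‖g‖ ^ 2 ≤ 0 := by linarith
  have h5 : ‖g‖ ^ 2 ≤ 0 := by
    by_contra h
    exact absurd h4 (not_le.2 (mul_pos (inv_pos.2 hL) (not_le.1 h)))
  have h6 := hPL.2 x
  have h7 := hPL.1 x
  nlinarith

end Convergence

end RMarina

end

/-! ### The convergence theorem. -/

open RMarina in
theorem mainTheorem11 {d n : ℕ} (hn : 0 < n)
    -- a geodesically complete smooth Riemannian manifold
    {M : Type*} [TopologicalSpace M] [T2Space M] [SecondCountableTopology M]
    [ChartedSpace (EuclideanSpace ℝ (Fin d)) M] [IsManifold (𝓡 d) ∞ M]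
    [RiemannianBundle (fun x : M => TangentSpace (𝓡 d) x)]
    [IsContMDiffRiemannianBundle (𝓡 d) ∞ (EuclideanSpace ℝ (Fin d))
      (fun x : M => TangentSpace (𝓡 d) x)]
    (hM : RMarina.GeodesicallyComplete d M)
    -- the objective
    (f : Fin n → M → ℝ) (L μ fstar : ℝ) (hL : 0 < L) (hμ : 0 < μ)
    (hsmooth : ∀ i, RMarina.GSmooth (d := d) L (f i))
    (hPL : RMarina.PLCondition d μ fstar (RMarina.average f))
    -- the compressors
    {S : Type*} [MeasurableSpace S] (ν : Measure S) [IsProbabilityMeasure ν]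
    (omega : ℝ) (homega : 0 ≤ omega)
    (Q : Fin n → (x : M) → S → TangentSpace (𝓡 d) x → TangentSpace (𝓡 d) x)
    (hQ : ∀ i, RMarina.IsUnbiasedCompressor ν omega (Q i))
    -- the parameters of the method
    (p γ : ℝ) (hp : 0 < p) (hp1 : p ≤ 1) (hγ : 0 < γ)
    (hγle : γ ≤ min (1 / (L * (1 + √(2 * (1 - p) * omega / (p * n))))) (p / (2 * μ)))
    (x₀ : M)
    -- the randomness: coin and seeds of iteration `k` are independent of the past `ℱ k`
    {Ω : Type*} [mΩ : MeasurableSpace Ω] (P : Measure Ω) [IsProbabilityMeasure P]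
    (ℱ : Filtration ℕ mΩ) (Z : ℕ → Ω → Bool × (Fin n → S))
    (hZmeas : ∀ k, Measurable[ℱ (k + 1)] (Z k))
    (hZlaw : ∀ k, P.map (Z k) = RMarina.stepLaw n p ν)
    (hZindep : ∀ k, Indep (MeasurableSpace.comap (Z k) inferInstance) (ℱ k) P)
    (hadapted : RMarina.Adapted ℱ f γ
      (fun k a => RMarina.run f Q γ x₀ (fun j => Z j a) k))
    (K : ℕ) :
    Integrable (fun a => RMarina.average f (RMarina.iterate f Q γ x₀ Z K a)) P ∧
    ∫ a, (RMarina.average f (RMarina.iterate f Q γ x₀ Z K a) - fstar) ∂P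
      ≤ (1 - γ * μ) ^ K * (RMarina.average f x₀ - fstar) ∧
    ∀ xstar : M, (∀ y, RMarina.average f xstar ≤ RMarina.average f y) →
      ∫ a, (RMarina.average f (RMarina.iterate f Q γ x₀ Z K a) - RMarina.average f xstar) ∂P
        ≤ (1 - γ * μ) ^ K * (RMarina.average f x₀ - RMarina.average f xstar) := by
  set σ : ℕ → Ω → State d n M := fun k a => run f Q γ x₀ (fun j => Z j a) k with hσ
  have hγμ : 0 ≤ 1 - γ * μ := by
    have h := hγle.trans (min_le_right _ _)
    rw [le_div_iff₀ (by positivity)] at h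
    linarith
  have hstep : ∀ k, ∫⁻ a, ENNReal.ofReal ((σ (k + 1) a).lyapunov f fstar (γ / p)) ∂P ≤
      ENNReal.ofReal (1 - γ * μ) *
        ∫⁻ a, ENNReal.ofReal ((σ k a).lyapunov f fstar (γ / p)) ∂P := by
    intro k
    -- Measurability with respect to the past σ-algebra, not merely the ambient one, is what allows
    -- the fresh randomness to be integrated out separately.
    have hmeas : Measurable[(ℱ k).prod inferInstance] fun q : Ω × (Bool × (Fin n → S)) =>
        ((σ k q.1).step f Q γ q.2.1 q.2.2).lyapunov f fstar (γ / p) :=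
      @measurable_lyapunov_step d n M _ _ _ _ _ _ S _ hn L f hsmooth ν omega Q hQ Ω (ℱ k) γ fstar
        (γ / p) (σ k) (fun i => (hadapted k i).2.2.1) (fun i => (hadapted k i).2.2.2)
    have h1 := lintegral_comp_indep (P := P) (ℱ.le k) ((hZmeas k).mono (ℱ.le _) le_rfl) (hZindep k)
      hmeas.ennreal_ofReal
    calc ∫⁻ a, ENNReal.ofReal ((σ (k + 1) a).lyapunov f fstar (γ / p)) ∂P
        = ∫⁻ a, ∫⁻ z, ENNReal.ofReal (((σ k a).step f Q γ z.1 z.2).lyapunov f fstar (γ / p))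
            ∂(P.map (Z k)) ∂P := h1
      _ ≤ ∫⁻ a, ENNReal.ofReal (1 - γ * μ) *
            ENNReal.ofReal ((σ k a).lyapunov f fstar (γ / p)) ∂P := by
          refine lintegral_mono fun a => ?_
          rw [hZlaw k]
          exact (σ k a).lintegral_lyapunov_step_le hM hn hL hμ hsmooth hPL homega hQ hp hp1 hγ hγle
            (measurable_lyapunov_step_right hn hsmooth hQ γ fstar (γ / p) (σ k a))
      _ = _ := lintegral_const_mul' _ _ ENNReal.ofReal_ne_top
  have hbound : ∀ k, ∫⁻ a, ENNReal.ofReal ((σ k a).lyapunov f fstar (γ / p)) ∂P ≤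
      ENNReal.ofReal ((1 - γ * μ) ^ k * (average f x₀ - fstar)) := by
    intro k
    induction k with
    | zero =>
      have h0 : ∀ a, (σ 0 a).lyapunov f fstar (γ / p) = average f x₀ - fstar := fun a =>
        lyapunov_run_zero f Q γ fstar (γ / p) x₀ _
      simp [h0]
    | succ k ih =>
      refine (hstep k).trans ((mul_le_mul_right ih _).trans (le_of_eq ?_))
      rw [← ENNReal.ofReal_mul hγμ, pow_succ']
      ring_nf
  have hF0 : ∀ x, 0 ≤ average f x - fstar := fun x => sub_nonneg.2 (hPL.1 x)
  have hmeasF : Measurable fun a => average f (iterate f Q γ x₀ Z K a) - fstar := by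
    borelize M
    have h := measurable_proj_of_measurable ((hadapted K ⟨0, hn⟩).1.mono (ℱ.le K) le_rfl)
    exact ((continuous_average hsmooth).measurable.comp h).sub_const fstar
  have hle : ∫⁻ a, ENNReal.ofReal (average f (iterate f Q γ x₀ Z K a) - fstar) ∂P ≤
      ENNReal.ofReal ((1 - γ * μ) ^ K * (average f x₀ - fstar)) := by
    refine (lintegral_mono fun a => ENNReal.ofReal_le_ofReal ?_).trans (hbound K)
    -- The nonnegative error term of the Lyapunov function is dropped.
    exact le_add_of_nonneg_right (by positivity)
  have hint : Integrable (fun a => average f (iterate f Q γ x₀ Z K a) - fstar) P := by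
    refine ⟨hmeasF.aestronglyMeasurable, ?_⟩
    rw [hasFiniteIntegral_iff_ofReal (Filter.Eventually.of_forall fun a => hF0 _)]
    exact hle.trans_lt ENNReal.ofReal_lt_top
  have hmain : ∫ a, (average f (iterate f Q γ x₀ Z K a) - fstar) ∂P ≤
      (1 - γ * μ) ^ K * (average f x₀ - fstar) := by
    rw [integral_eq_lintegral_of_nonneg_ae (Filter.Eventually.of_forall fun a => hF0 _)
      hmeasF.aestronglyMeasurable]
    exact ENNReal.toReal_le_of_le_ofReal (mul_nonneg (pow_nonneg hγμ _) (hF0 _)) hle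
  refine ⟨?_, hmain, fun xstar hxstar => ?_⟩
  · refine (hint.add (integrable_const fstar)).congr (Filter.Eventually.of_forall fun a => ?_)
    simp
  · rw [hPL.eq_of_minimizer hM hn hL hμ hsmooth hxstar]
    exact hmain
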